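/- Setting. For $c\in\mathbb{C}^4$ let $x(c)$ be a formal basis vector, thought of as the monomial $x_1^{c_1}\cdots x_4^{c_4}$, and for $1\le i\le 4$ let $q_i,p_i$ be the linear operators with $q_i x(c)=(c_i+1)x(c+\epsilon_i)$, $p_i x(c)=x(c-\epsilon_i)$ if $c_i$ is a negative integer, and $q_i x(c)=x(c+\epsilon_i)$, $p_i x(c)=c_i x(c-\epsilon_i)$ otherwise. They satisfy the Weyl algebra relations, so $E_{i,j}\mapsto q_ip_j$ is a representation of $\mathfrak{gl}_4(\mathbb{C})$. Let $a_1,a_2\in\mathbb{C}\setminus\mathbb{Z}$ and $a=(-1,a_1,a_2,0)$. Let $N=N_{a_1,a_2}$ be the $\mathfrak{sl}_4(\mathbb{C})$-module spanned by the $x(c)$ such that $c_i-a_i\in\mathbb{Z}$ for all $i$, $c_i$ is a negative integer if and only if $a_i$ is, and $\sum_i c_i=\sum_i a_i$. Let $$\mathfrak{b}=\left\{\begin{pmatrix}A&0\\0&A\end{pmatrix}:A\in\mathfrak{sl}_2(\mathbb{C})\right\}\cong\mathfrak{sl}_2,\qquad \mathfrak{a}=\langle X,H,Y\rangle\cong\mathfrak{sl}_2,$$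 where $Y=E_{1,3}+E_{2,4}$, $X=E_{3,1}+E_{4,2}$, $H=E_{1,1}+E_{2,2}-E_{3,3}-E_{4,4}$; each is the commutant of the other. For $\mathfrak{b}$ (raising element $E_{1,2}+E_{3,4}$, Cartan element $E_{1,1}-E_{2,2}+E_{3,3}-E_{4,4}$) and for $\mathfrak{a}$ (raising element $Y$, Cartan element $H$) let $V(\mu)$ be the Verma module of highest weight $\mu\in\mathbb{C}$ and $L(\mu)$ its simple quotient. For $b\in\mathbb{Z}$ put $x(b,0)=x(-1,a_1+b,a_2-b,0)\in N$. For a $\mathfrak{b}$-module $S$ and an $\mathfrak{a}$-module $T$, write $S\leftrightarrow T$ (at $b$) if $\mathcal{U}(\mathfrak{b})x(b,0)\cong S$ as $\mathfrak{b}$-modules, $\mathcal{U}(\mathfrak{a})x(b,0)\cong T$ as $\mathfrak{a}$-modules, and the $\mathfrak{b}\oplus\mathfrak{a}$-submodule of $N$ generated by $x(b,0)$ is isomorphic to the outer tensor product $S\otimes T$. Theorem. Let $a_1,a_2\in\mathbb{C}\setminus\mathbb{Z}$ with $a_1-a_2\in\mathbb{Z}$, and let $b\in\mathbb{Z}$.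 (1) If $a_1-a_2+2b=0$, then $\mathcal{U}(\mathfrak{b})x(b,0)$ is a simple $\mathfrak{b}$-module isomorphic to $L(-1)$, and $L(-1)\leftrightarrow L(-1)$. (2) If $a_1-a_2+2b>0$, then $\mathcal{U}(\mathfrak{b})x(b,0)$ is a simple $\mathfrak{b}$-module isomorphic to $L(a_2-a_1-2b-1)$, and $L(a_2-a_1-2b-1)\leftrightarrow V(a_1-a_2+2b-1)$. (3) If $a_1-a_2+2b<0$, then $\mathcal{U}(\mathfrak{b})x(b,0)$ is an indecomposable $\mathfrak{b}$-module of length $2$ isomorphic to $V(a_2-a_1-2b-1)$, and $V(a_2-a_1-2b-1)\leftrightarrow L(a_1-a_2+2b-1)$. -/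

import Mathlib

open scoped TensorProduct

attribute [local instance 100] LieRing.ofAssociativeRing

noncomputable section

namespace HoweSl

/-! ### Highest weight modules of a Lie algebra with a chosen raising element `e` and Cartan
element `h` (used for Lie algebras isomorphic to `sl₂`) -/

section HighestWeight

variable {𝔩 : Type} [LieRing 𝔩] [LieAlgebra ℂ 𝔩]

/-- The left ideal of `U(𝔩)` generated by `e` and `h - μ`. -/
def vermaIdeal (e h : 𝔩) (μ : ℂ) : Submodule (UniversalEnvelopingAlgebra ℂ 𝔩)
    (UniversalEnvelopingAlgebra ℂ 𝔩) :=
  Submodule.span (UniversalEnvelopingAlgebra ℂ 𝔩)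
    {UniversalEnvelopingAlgebra.ι ℂ e,
      UniversalEnvelopingAlgebra.ι ℂ h - algebraMap ℂ (UniversalEnvelopingAlgebra ℂ 𝔩) μ}

/-- The Verma module `V(μ) = U(𝔩) / (U(𝔩) e + U(𝔩) (h - μ))`, where `𝔩 ≅ sl₂` has standard
basis `h, e, f`. -/
def Verma (e h : 𝔩) (μ : ℂ) : Type :=
  UniversalEnvelopingAlgebra ℂ 𝔩 ⧸ vermaIdeal e h μ

variable (e h : 𝔩) (μ : ℂ)

instance : AddCommGroup (Verma e h μ) :=
  inferInstanceAs (AddCommGroup (UniversalEnvelopingAlgebra ℂ 𝔩 ⧸ vermaIdeal e h μ))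

instance : Module (UniversalEnvelopingAlgebra ℂ 𝔩) (Verma e h μ) :=
  inferInstanceAs (Module (UniversalEnvelopingAlgebra ℂ 𝔩)
    (UniversalEnvelopingAlgebra ℂ 𝔩 ⧸ vermaIdeal e h μ))

instance : Module ℂ (Verma e h μ) :=
  inferInstanceAs (Module ℂ (UniversalEnvelopingAlgebra ℂ 𝔩 ⧸ vermaIdeal e h μ))

instance : IsScalarTower ℂ (UniversalEnvelopingAlgebra ℂ 𝔩) (Verma e h μ) :=
  inferInstanceAs (IsScalarTower ℂ (UniversalEnvelopingAlgebra ℂ 𝔩)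
    (UniversalEnvelopingAlgebra ℂ 𝔩 ⧸ vermaIdeal e h μ))

/-- `𝔩` acts on the Verma module by left multiplication in `U(𝔩)`. -/
instance : LieRingModule 𝔩 (Verma e h μ) where
  bracket x v := UniversalEnvelopingAlgebra.ι ℂ x • v
  add_lie x y v := by rw [map_add, add_smul]
  lie_add x v w := smul_add _ v w
  leibniz_lie x y v := by
    rw [LieHom.map_lie, LieRing.of_associative_ring_bracket, sub_smul, mul_smul, mul_smul,
      sub_add_cancel]

instance : LieModule ℂ 𝔩 (Verma e h μ) where
  smul_lie t x v := by
    change UniversalEnvelopingAlgebra.ι ℂ (t • x) • v = t • UniversalEnvelopingAlgebra.ι ℂ x • v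
    rw [map_smul, smul_assoc]
  lie_smul t x v := by
    change UniversalEnvelopingAlgebra.ι ℂ x • (t • v) = t • UniversalEnvelopingAlgebra.ι ℂ x • v
    rw [← algebraMap_smul (UniversalEnvelopingAlgebra ℂ 𝔩) t v, ← mul_smul,
      ← Algebra.commutes, mul_smul, algebraMap_smul]

/-- The largest proper submodule of `V(μ)`: the sum of all proper submodules. -/
def vermaRadical : LieSubmodule ℂ 𝔩 (Verma e h μ) :=
  sSup {P | P ≠ ⊤}

/-- The simple highest weight module `L(μ)`: the quotient of the Verma module `V(μ)` by its largest
proper submodule. -/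
abbrev SimpleHW : Type := Verma e h μ ⧸ vermaRadical e h μ

end HighestWeight

/-! ### Length and indecomposability -/

section Length

variable (𝔩 M : Type) [LieRing 𝔩] [LieAlgebra ℂ 𝔩] [AddCommGroup M] [Module ℂ M]
  [LieRingModule 𝔩 M]

/-- The length of a Lie module: the supremum of the lengths of strict chains of submodules. -/
def lieLength : ℕ∞ := Order.height (⊤ : LieSubmodule ℂ 𝔩 M)

/-- A nonzero Lie module that is not the direct sum of two nonzero submodules. -/
def IsIndecomposable : Prop :=
  Nontrivial M ∧ ∀ P Q : LieSubmodule ℂ 𝔩 M, IsCompl P Q → P = ⊥ ∨ Q = ⊥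

end Length

/-! ### The Weyl algebra operators and the modules `N(a)` -/

section Weyl

variable {ι : Type}

/-- `z` is a negative integer. -/
def IsNegInt (z : ℂ) : Prop := ∃ k : ℕ, z = -((k : ℂ) + 1)

/-- The vector space with basis the formal monomials `x(b)`, `b ∈ ℂ^ι`. All the modules
considered below are spanned by subsets of this basis. -/
def Mono (ι : Type) : Type := (ι → ℂ) →₀ ℂ

instance : AddCommGroup (Mono ι) := inferInstanceAs (AddCommGroup ((ι → ℂ) →₀ ℂ))

instance : Module ℂ (Mono ι) := inferInstanceAs (Module ℂ ((ι → ℂ) →₀ ℂ))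

/-- The basis vector `x(b)`. -/
def mono (b : ι → ℂ) : Mono ι := Finsupp.single b (1 : ℂ)

/-- The linear map with prescribed values on the basis vectors. -/
def monoLift (φ : (ι → ℂ) → Mono ι) : Mono ι →ₗ[ℂ] Mono ι :=
  Finsupp.lift (Mono ι) ℂ (ι → ℂ) φ

theorem monoLift_mono (φ : (ι → ℂ) → Mono ι) (b : ι → ℂ) : monoLift φ (mono b) = φ b := by
  change Finsupp.sum (Finsupp.single b (1 : ℂ)) (fun x r => r • φ x) = φ b
  exact (Finsupp.sum_single_index (h := fun x r => r • φ x) (zero_smul ℂ (φ b))).trans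
    (one_smul ℂ (φ b))

theorem mono_ext {f g : Mono ι →ₗ[ℂ] Mono ι} (h : ∀ b, f (mono b) = g (mono b)) : f = g :=
  Finsupp.lhom_ext' fun b => LinearMap.ext_ring (h b)

open Classical in
/-- The coefficient of `x(b + εᵢ)` in `qᵢ x(b)`, as a function of `bᵢ`. -/
def qCoeff (z : ℂ) : ℂ := if IsNegInt z then z + 1 else 1

open Classical in
/-- The coefficient of `x(b - εᵢ)` in `pᵢ x(b)`, as a function of `bᵢ`. -/
def pCoeff (z : ℂ) : ℂ := if IsNegInt z then 1 else z

variable [DecidableEq ι]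

/-- The multiplication operator `qᵢ`: `qᵢ x(b) = (bᵢ + 1) x(b + εᵢ)` if `bᵢ` is a negative integer,
and `qᵢ x(b) = x(b + εᵢ)` otherwise. -/
def opQ (i : ι) : Mono ι →ₗ[ℂ] Mono ι :=
  monoLift fun b => qCoeff (b i) • mono (b + Pi.single i 1)

/-- The derivation operator `pᵢ`: `pᵢ x(b) = x(b - εᵢ)` if `bᵢ` is a negative integer,
and `pᵢ x(b) = bᵢ x(b - εᵢ)` otherwise. -/
def opP (i : ι) : Mono ι →ₗ[ℂ] Mono ι :=
  monoLift fun b => pCoeff (b i) • mono (b - Pi.single i 1)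

theorem opQ_mono (i : ι) (b : ι → ℂ) :
    opQ i (mono b) = qCoeff (b i) • mono (b + Pi.single i 1) := monoLift_mono _ _

theorem opP_mono (i : ι) (b : ι → ℂ) :
    opP i (mono b) = pCoeff (b i) • mono (b - Pi.single i 1) := monoLift_mono _ _

theorem isNegInt_neg_one : IsNegInt (-1) := ⟨0, by simp⟩

theorem not_isNegInt_zero : ¬ IsNegInt 0 := by
  rintro ⟨k, hk⟩
  have : ((k + 1 : ℕ) : ℂ) = 0 := by push_cast; exact neg_eq_zero.mp hk.symm
  exact Nat.succ_ne_zero k (Nat.cast_eq_zero.mp this)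

theorem isNegInt_sub_one {z : ℂ} (hz : IsNegInt z) : IsNegInt (z - 1) := by
  obtain ⟨k, rfl⟩ := hz
  exact ⟨k + 1, by push_cast; ring⟩

theorem isNegInt_of_sub_one {z : ℂ} (hz : IsNegInt (z - 1)) (h0 : z ≠ 0) : IsNegInt z := by
  obtain ⟨k, hk⟩ := hz
  cases k with
  | zero => exact absurd (by linear_combination hk) h0
  | succ k => exact ⟨k, by push_cast at hk; linear_combination hk⟩

theorem isNegInt_sub_one_iff {z : ℂ} (h0 : z ≠ 0) : IsNegInt (z - 1) ↔ IsNegInt z :=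
  ⟨fun h => isNegInt_of_sub_one h h0, isNegInt_sub_one⟩

theorem isNegInt_add_one_iff {z : ℂ} (h0 : z ≠ -1) : IsNegInt (z + 1) ↔ IsNegInt z := by
  have := isNegInt_sub_one_iff (z := z + 1) (fun h => h0 (by linear_combination h))
  rw [add_sub_cancel_right] at this
  exact this.symm

theorem weyl_coeff (z : ℂ) :
    qCoeff z * pCoeff (z + 1) - pCoeff z * qCoeff (z - 1) = 1 := by
  by_cases h : IsNegInt z
  · have h1 := isNegInt_sub_one h
    by_cases h2 : z = -1
    · subst h2
      simp [qCoeff, pCoeff, h, h1]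
    · have h3 := (isNegInt_add_one_iff h2).mpr h
      simp [qCoeff, pCoeff, h, h1, h3]
  · have h2 : z ≠ -1 := fun h2 => h (h2 ▸ isNegInt_neg_one)
    have h3 : ¬ IsNegInt (z + 1) := fun h3 => h ((isNegInt_add_one_iff h2).mp h3)
    by_cases h0 : z = 0
    · subst h0
      simp [qCoeff, pCoeff, not_isNegInt_zero]
    · have h1 : ¬ IsNegInt (z - 1) := fun h1 => h (isNegInt_of_sub_one h1 h0)
      simp [qCoeff, pCoeff, h, h1, h3]

/-- The Weyl algebra relations. -/
theorem opQ_comm (i j : ι) : opQ i * opQ j = opQ j * opQ i := by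
  refine mono_ext fun b => ?_
  rcases eq_or_ne i j with rfl | h
  · rfl
  · simp only [Module.End.mul_apply, opQ_mono, map_smul, smul_smul, Pi.add_apply,
      Pi.single_eq_of_ne h, Pi.single_eq_of_ne h.symm, add_zero]
    rw [add_right_comm, mul_comm]

theorem opP_comm (i j : ι) : opP i * opP j = opP j * opP i := by
  refine mono_ext fun b => ?_
  rcases eq_or_ne i j with rfl | h
  · rfl
  · simp only [Module.End.mul_apply, opP_mono, map_smul, smul_smul, Pi.sub_apply,
      Pi.single_eq_of_ne h, Pi.single_eq_of_ne h.symm, sub_zero]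
    rw [sub_right_comm, mul_comm]

theorem opP_opQ (i j : ι) : opP j * opQ i = opQ i * opP j + if i = j then 1 else 0 := by
  refine mono_ext fun b => ?_
  rcases eq_or_ne i j with rfl | h
  · simp only [Module.End.mul_apply, opP_mono, opQ_mono, map_smul, smul_smul, Pi.sub_apply,
      Pi.add_apply, Pi.single_eq_same, LinearMap.add_apply, if_true, Module.End.one_apply,
      add_sub_cancel_right, sub_add_cancel]
    have h1 : qCoeff (b i) * pCoeff (b i + 1) = pCoeff (b i) * qCoeff (b i - 1) + 1 := by
      linear_combination weyl_coeff (b i)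
    rw [h1, add_smul, one_smul]
  · simp only [Module.End.mul_apply, opP_mono, opQ_mono, map_smul, smul_smul, Pi.sub_apply,
      Pi.add_apply, if_neg h,
      Pi.single_eq_of_ne h, Pi.single_eq_of_ne h.symm, sub_zero, add_zero]
    rw [sub_add_eq_add_sub, mul_comm]

variable [Fintype ι]

/-- The linear map `gl(ι) → End(Mono ι)` with `E_{i,j} ↦ qᵢ pⱼ`. -/
def glLin : Matrix ι ι ℂ →ₗ[ℂ] Module.End ℂ (Mono ι) where
  toFun A := ∑ i, ∑ j, A i j • (opQ i * opP j)
  map_add' A B := by simp [add_smul, Finset.sum_add_distrib]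
  map_smul' c A := by simp [Finset.smul_sum, smul_smul]

theorem glLin_single (i j : ι) (c : ℂ) :
    glLin (Matrix.single i j c) = c • (opQ i * opP j) := by
  change ∑ k, ∑ l, Matrix.single i j c k l • (opQ k * opP l) = _
  rw [Finset.sum_eq_single i, Finset.sum_eq_single j]
  · simp
  · intro l _ hl
    simp [Matrix.single_apply_of_col_ne _ _ hl.symm]
  · simp
  · intro k _ hk
    exact Finset.sum_eq_zero fun l _ => by simp [Matrix.single_apply_of_row_ne hk.symm]
  · simp

theorem glLin_lie (A B : Matrix ι ι ℂ) : glLin ⁅A, B⁆ = ⁅glLin A, glLin B⁆ := by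
  induction A using Matrix.induction_on' with
  | h_zero => simp
  | h_add A A' h h' => simp [h, h', add_lie]
  | h_std_basis i j c =>
    induction B using Matrix.induction_on' with
    | h_zero => simp
    | h_add B B' h h' => simp [h, h', lie_add]
    | h_std_basis k l d =>
      have key : opQ i * opP j * (opQ k * opP l) - opQ k * opP l * (opQ i * opP j)
          = (if k = j then opQ i * opP l else 0) - (if i = l then opQ k * opP j else 0) := by
        have e1 : opQ i * opP j * (opQ k * opP l) = opQ i * (opP j * opQ k) * opP l := by
          simp only [mul_assoc]
        have e2 : opQ k * opP l * (opQ i * opP j) = opQ k * (opP l * opQ i) * opP j := by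
          simp only [mul_assoc]
        have e3 : opQ i * (opQ k * opP j) * opP l = opQ k * (opQ i * opP l) * opP j := by
          rw [← mul_assoc (opQ i), opQ_comm i k, mul_assoc, mul_assoc, opP_comm j l]
          simp only [mul_assoc]
        rw [e1, e2, opP_opQ, opP_opQ]
        simp only [mul_add, add_mul, e3]
        split_ifs <;> simp
      have m1 : Matrix.single i j c * Matrix.single k l d
          = if k = j then Matrix.single i l (c * d) else 0 := by
        split_ifs with h
        · subst h; simp
        · exact Matrix.single_mul_single_of_ne _ _ _ _ (Ne.symm h) _
      have m2 : Matrix.single k l d * Matrix.single i j c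
          = if i = l then Matrix.single k j (d * c) else 0 := by
        split_ifs with h
        · subst h; simp
        · exact Matrix.single_mul_single_of_ne _ _ _ _ (Ne.symm h) _
      rw [LieRing.of_associative_ring_bracket, LieRing.of_associative_ring_bracket, m1, m2]
      simp only [map_sub, glLin_single, smul_mul_smul_comm, mul_comm d c]
      rw [← smul_sub, key, smul_sub]
      split_ifs <;> simp [glLin_single]

/-- The representation of `gl(ι)` on the formal monomials, `E_{i,j} ↦ qᵢ pⱼ`. -/
def glRep : Matrix ι ι ℂ →ₗ⁅ℂ⁆ Module.End ℂ (Mono ι) :=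
  { glLin with map_lie' := fun {A B} => glLin_lie A B }

instance : LieRingModule (Matrix ι ι ℂ) (Mono ι) := LieRingModule.compLieHom (Mono ι) glRep

instance : LieModule ℂ (Matrix ι ι ℂ) (Mono ι) := LieModule.compLieHom (Mono ι) glRep

theorem gl_lie_mono (A : Matrix ι ι ℂ) (b : ι → ℂ) :
    ⁅A, mono b⁆ = ∑ i, ∑ j, (A i j * pCoeff (b j) * qCoeff ((b - Pi.single j 1 : ι → ℂ) i)) •
      mono (b - Pi.single j 1 + Pi.single i 1) := by
  change (∑ i, ∑ j, A i j • (opQ i * opP j)) (mono b) = _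
  simp only [LinearMap.sum_apply, LinearMap.smul_apply, Module.End.mul_apply, opP_mono, opQ_mono,
    map_smul, smul_smul, mul_assoc]

/-- The set `𝒫ₐ` of admissible tuples: `b - a` is integral, `b` and `a` have negative integers in
the same places, and `∑ bᵢ = ∑ aᵢ`. -/
def admissible (a : ι → ℂ) : Set (ι → ℂ) :=
  {b | (∀ i, ∃ z : ℤ, b i - a i = z) ∧ (∀ i, IsNegInt (b i) ↔ IsNegInt (a i)) ∧
    ∑ i, b i = ∑ i, a i}

theorem admissible_move {a b : ι → ℂ} (hb : b ∈ admissible a) (i j : ι)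
    (hp : pCoeff (b j) ≠ 0) (hq : qCoeff ((b - Pi.single j 1 : ι → ℂ) i) ≠ 0) :
    b - Pi.single j 1 + Pi.single i 1 ∈ admissible a := by
  obtain ⟨h1, h2, h3⟩ := hb
  have hj : b j ≠ 0 := by
    intro h
    simp [pCoeff, h, not_isNegInt_zero] at hp
  have hi : (b - Pi.single j 1 : ι → ℂ) i ≠ -1 := by
    intro h
    simp [qCoeff, h, isNegInt_neg_one] at hq
  have hn : ∀ k, IsNegInt ((b - Pi.single j 1 : ι → ℂ) k) ↔ IsNegInt (a k) := by
    intro k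
    rw [← h2 k]
    rcases eq_or_ne k j with rfl | hk
    · simpa using isNegInt_sub_one_iff hj
    · simp [Pi.single_eq_of_ne hk]
  refine ⟨fun k => ?_, fun k => ?_, ?_⟩
  · obtain ⟨z, hz⟩ := h1 k
    refine ⟨z - (Pi.single j 1 : ι → ℤ) k + (Pi.single i 1 : ι → ℤ) k, ?_⟩
    have hc : ∀ m : ι, (((Pi.single m 1 : ι → ℤ) k : ℤ) : ℂ) = (Pi.single m 1 : ι → ℂ) k := by
      intro m
      rcases eq_or_ne k m with rfl | hk
      · simp
      · simp [Pi.single_eq_of_ne hk]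
    push_cast
    rw [hc, hc, ← hz]
    simp only [Pi.add_apply, Pi.sub_apply]
    ring
  · rw [← hn k]
    rcases eq_or_ne k i with rfl | hk
    · rw [Pi.add_apply, Pi.single_eq_same]
      exact isNegInt_add_one_iff hi
    · rw [Pi.add_apply, Pi.single_eq_of_ne hk, add_zero]
  · simp [Finset.sum_add_distrib, Finset.sum_sub_distrib, h3]

/-- `N(a) = ⨁_{b ∈ 𝒫ₐ} ℂ x(b)`, as a module over `sl(ι)`. -/
def weightModule (a : ι → ℂ) :
    LieSubmodule ℂ (LieAlgebra.SpecialLinear.sl ι ℂ) (Mono ι) where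
  __ := Submodule.span ℂ (mono '' admissible a)
  lie_mem := by
    intro A v hv
    change v ∈ Submodule.span ℂ (mono '' admissible a) at hv
    change ⁅A, v⁆ ∈ Submodule.span ℂ (mono '' admissible a)
    induction hv using Submodule.span_induction with
    | zero => rw [lie_zero]; exact zero_mem _
    | add v w _ _ h h' => rw [lie_add]; exact add_mem h h'
    | smul c v _ h => rw [lie_smul]; exact Submodule.smul_mem _ c h
    | mem v hv =>
      obtain ⟨b, hb, rfl⟩ := hv
      change ⁅(A : Matrix ι ι ℂ), mono b⁆ ∈ _
      rw [gl_lie_mono]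
      refine Submodule.sum_mem _ fun i _ => Submodule.sum_mem _ fun j _ => ?_
      by_cases hp : pCoeff (b j) = 0
      · rw [hp, mul_zero, zero_mul, zero_smul]; exact zero_mem _
      by_cases hq : qCoeff ((b - Pi.single j 1 : ι → ℂ) i) = 0
      · rw [hq, mul_zero, zero_smul]; exact zero_mem _
      exact Submodule.smul_mem _ _
        (Submodule.subset_span ⟨_, admissible_move hb i j hp hq, rfl⟩)

theorem mono_mem_weightModule {a b : ι → ℂ} (hb : b ∈ admissible a) :
    mono b ∈ weightModule a :=
  Submodule.subset_span ⟨b, hb, rfl⟩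

end Weyl

/-! ### The dual pair `(𝔞, 𝔟)` in `sl_{2n}`; the index set `{1, …, 2n}` is `Fin n ⊕ Fin n` -/

section DualPair

/-- `sl_{2n}(ℂ)`. -/
abbrev slTwo (n : ℕ) : LieSubalgebra ℂ (Matrix (Fin n ⊕ Fin n) (Fin n ⊕ Fin n) ℂ) :=
  LieAlgebra.SpecialLinear.sl (Fin n ⊕ Fin n) ℂ

/-- The map `A ↦ diag(A, A)` from `sl_n` to `sl_{2n}`. -/
def diagEmb (n : ℕ) : LieAlgebra.SpecialLinear.sl (Fin n) ℂ →ₗ⁅ℂ⁆ slTwo n where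
  toFun A := ⟨Matrix.fromBlocks A.1 0 0 A.1, by
    have h : Matrix.trace A.1 = 0 := A.2
    change Matrix.trace (Matrix.fromBlocks A.1 0 0 A.1) = 0
    simp [Matrix.trace, Fintype.sum_sum_type] at h ⊢; exact h⟩
  map_add' A B := by
    apply Subtype.ext
    simp [Matrix.fromBlocks_add]
  map_smul' c A := by
    apply Subtype.ext
    simp [Matrix.fromBlocks_smul]
  map_lie' {A B} := by
    apply Subtype.ext
    simp [LieRing.of_associative_ring_bracket, Matrix.fromBlocks_multiply, sub_eq_add_neg,
      Matrix.fromBlocks_neg, Matrix.fromBlocks_add]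

/-- `𝔟 = {diag(A, A) : A ∈ sl_n} ≅ sl_n`. -/
def algB (n : ℕ) : LieSubalgebra ℂ (slTwo n) := (diagEmb n).range

/-- `Y = ∑ᵢ E_{i,n+i}`. -/
def elY (n : ℕ) : slTwo n :=
  ⟨Matrix.fromBlocks 0 1 0 0, by
    change Matrix.trace (n := Fin n ⊕ Fin n) (R := ℂ) _ = 0
    simp [Matrix.trace, Fintype.sum_sum_type]⟩

/-- `X = ∑ᵢ E_{n+i,i}`. -/
def elX (n : ℕ) : slTwo n :=
  ⟨Matrix.fromBlocks 0 0 1 0, by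
    change Matrix.trace (n := Fin n ⊕ Fin n) (R := ℂ) _ = 0
    simp [Matrix.trace, Fintype.sum_sum_type]⟩

/-- `H = ∑ᵢ (E_{i,i} - E_{n+i,n+i})`, which is
`H_{α₁} + 2 H_{α₂} + ⋯ + n H_{αₙ} + (n-1) H_{αₙ₊₁} + ⋯ + H_{α₂ₙ₋₁}`. -/
def elH (n : ℕ) : slTwo n :=
  ⟨Matrix.fromBlocks 1 0 0 (-1), by
    change Matrix.trace (n := Fin n ⊕ Fin n) (R := ℂ) _ = 0
    simp [Matrix.trace, Fintype.sum_sum_type]⟩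

/-- `𝔞 = ⟨X, H, Y⟩ ≅ sl₂`, the commutant of `𝔟`. -/
def algA (n : ℕ) : LieSubalgebra ℂ (slTwo n) :=
  LieSubalgebra.lieSpan ℂ (slTwo n) {elX n, elH n, elY n}

/-- The raising element `Y` of `𝔞`. -/
def raiseA (n : ℕ) : algA n := ⟨elY n, LieSubalgebra.subset_lieSpan (by simp)⟩

/-- The Cartan element `H` of `𝔞`. -/
def cartanA (n : ℕ) : algA n := ⟨elH n, LieSubalgebra.subset_lieSpan (by simp)⟩

/-- For `n = 2`, the raising element `diag(E₁₂, E₁₂)` of `𝔟`. -/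
def raiseB : algB 2 :=
  ⟨diagEmb 2 (LieAlgebra.SpecialLinear.single 0 1 (by decide) 1), LieHom.mem_range_self _ _⟩

/-- For `n = 2`, the Cartan element `diag(E₁₁ - E₂₂, E₁₁ - E₂₂)` of `𝔟`. -/
def cartanB : algB 2 :=
  ⟨diagEmb 2 (LieAlgebra.SpecialLinear.singleSubSingle 0 1 1), LieHom.mem_range_self _ _⟩

/-- The tuple `(-1, …, -1, u, v, 0, …, 0)`, with `u` in place `n` and `v` in place `n + 1`. -/
def tuple (n : ℕ) (u v : ℂ) : Fin n ⊕ Fin n → ℂ :=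
  Sum.elim (fun i => if (i : ℕ) + 1 = n then u else -1) (fun j => if (j : ℕ) = 0 then v else 0)

/-- `N_{a₁,a₂} = N(-1, …, -1, a₁, a₂, 0, …, 0)`. -/
abbrev modN (n : ℕ) (a₁ a₂ : ℂ) : LieSubmodule ℂ (slTwo n) (Mono (Fin n ⊕ Fin n)) :=
  weightModule (tuple n a₁ a₂)

theorem not_isNegInt_add_int {u : ℂ} (hu : ∀ z : ℤ, u ≠ z) (b : ℤ) : ¬ IsNegInt (u + b) := by
  rintro ⟨k, hk⟩
  refine hu (-(k + 1) - b) ?_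
  push_cast
  linear_combination hk

theorem tuple_admissible (n : ℕ) {a₁ a₂ : ℂ} (h₁ : ∀ z : ℤ, a₁ ≠ z) (h₂ : ∀ z : ℤ, a₂ ≠ z)
    (b : ℤ) : tuple n (a₁ + b) (a₂ - b) ∈ admissible (tuple n a₁ a₂) := by
  have e₁ : ¬ IsNegInt a₁ := by simpa using not_isNegInt_add_int h₁ 0
  have e₂ : ¬ IsNegInt a₂ := by simpa using not_isNegInt_add_int h₂ 0
  have f₁ := not_isNegInt_add_int h₁ b
  have f₂ : ¬ IsNegInt (a₂ - b) := by simpa [sub_eq_add_neg] using not_isNegInt_add_int h₂ (-b)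
  refine ⟨?_, ?_, ?_⟩
  · rintro (i | j)
    · by_cases h : (i : ℕ) + 1 = n
      · exact ⟨b, by simp [tuple, h]⟩
      · exact ⟨0, by simp [tuple, h]⟩
    · by_cases h : (j : ℕ) = 0
      · exact ⟨-b, by simp [tuple, h]⟩
      · exact ⟨0, by simp [tuple, h]⟩
  · rintro (i | j)
    · by_cases h : (i : ℕ) + 1 = n <;> simp [tuple, h, e₁, f₁]
    · by_cases h : (j : ℕ) = 0 <;> simp [tuple, h, e₂, f₂]
  · rw [Fintype.sum_sum_type, Fintype.sum_sum_type]
    cases n with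
    | zero => simp
    | succ m =>
      have key : ∀ u v : ℂ, (∑ i : Fin (m + 1), tuple (m + 1) u v (Sum.inl i)) +
          ∑ j : Fin (m + 1), tuple (m + 1) u v (Sum.inr j) = -m + u + v := by
        intro u v
        rw [Fin.sum_univ_castSucc, Fin.sum_univ_succ (fun j => tuple (m + 1) u v (Sum.inr j))]
        have : ∀ i : Fin m, (i : ℕ) ≠ m := fun i => i.2.ne
        simp [tuple, this]
      rw [key, key]
      ring

/-- The vector `x(b, 0) = x(-1, …, -1, a₁ + b, a₂ - b, 0, …, 0)` of `N_{a₁,a₂}`, where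
`a₁, a₂ ∈ ℂ ∖ ℤ` and `b ∈ ℤ`. -/
def hwVec (n : ℕ) {a₁ a₂ : ℂ} (h₁ : ∀ z : ℤ, a₁ ≠ z) (h₂ : ∀ z : ℤ, a₂ ≠ z) (b : ℤ) :
    modN n a₁ a₂ :=
  ⟨mono (tuple n (a₁ + b) (a₂ - b)), mono_mem_weightModule (tuple_admissible n h₁ h₂ b)⟩

/-- `U(𝔰) x`: the `𝔰`-submodule of `N_{a₁,a₂}` generated by `x`, for a subalgebra `𝔰` of
`sl_{2n}`. -/
abbrev gen {n : ℕ} {a₁ a₂ : ℂ} (𝔰 : LieSubalgebra ℂ (slTwo n)) (x : modN n a₁ a₂) :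
    LieSubmodule ℂ 𝔰 (modN n a₁ a₂) :=
  LieSubmodule.lieSpan ℂ 𝔰 {x}

/-- The correspondence `S ↔ T` realized by the vector `x` of `N_{a₁,a₂}`, where `S` is a `𝔟`-module
and `T` an `𝔞`-module: `U(𝔟) x ≅ S`, `U(𝔞) x ≅ T`, and the module over `𝔟 + 𝔞 = 𝔟 ⊕ 𝔞` generated by
`x` is isomorphic to the outer tensor product `S ⊗ T`, on which `𝔟` acts through the first factor
and `𝔞` through the second. -/
def Corresponds {n : ℕ} {a₁ a₂ : ℂ} (x : modN n a₁ a₂)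
    (S : Type) [AddCommGroup S] [Module ℂ S] [LieRingModule (algB n) S]
    (T : Type) [AddCommGroup T] [Module ℂ T] [LieRingModule (algA n) T] : Prop :=
  Nonempty (gen (algB n) x ≃ₗ⁅ℂ, algB n⁆ S) ∧
  Nonempty (gen (algA n) x ≃ₗ⁅ℂ, algA n⁆ T) ∧
  ∃ φ : (S ⊗[ℂ] T) ≃ₗ[ℂ] gen (algB n ⊔ algA n) x,
    (∀ (B : algB n) (s : S) (t : T),
      (φ (⁅B, s⁆ ⊗ₜ[ℂ] t) : modN n a₁ a₂) = ⁅B, (φ (s ⊗ₜ[ℂ] t) : modN n a₁ a₂)⁆) ∧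
    (∀ (A : algA n) (s : S) (t : T),
      (φ (s ⊗ₜ[ℂ] ⁅A, t⁆) : modN n a₁ a₂) = ⁅A, (φ (s ⊗ₜ[ℂ] t) : modN n a₁ a₂)⁆)

end DualPair

end HoweSl

end

/-!
The vector `x(b, 0)` is primitive for both of the commuting `sl₂`-triples of `𝔟` and `𝔞`, of weights
`λ = a₂ - a₁ - 2b - 1` and `μ = a₁ - a₂ + 2b - 1`. The whole theorem follows from the fact that the
vectors `f_Bⁱ f_Aʲ x(b, 0)` are nonzero, where `f_B` and `f_A = X` are the lowering operators.

*Nonvanishing.* No power of one of the lowering operators kills `x(b, 0)`: along the exponents with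
last entry `0`, only one of the two terms of the operator contributes to the coefficients
(`pow_move_ne_zero`), and it contributes `1` at each step. For mixed powers, note that `λ + μ = -2`,
so one of the two integers `λ`, `μ` is negative. If it is `λ`, say, then each `f_Aʲ x(b, 0)` is a
primitive vector for `𝔟` of weight `λ`, and `e_Bⁱ f_Bⁱ` multiplies it by a nonzero number
(`pow_lowerB_pow_lowerA_ne_zero`).

*Verma modules.* A module generated by a primitive vector `v` of weight `μ` with `fᵏ v ≠ 0` for all
`k` has the basis `fᵏ v`, on which the action is determined by `μ`; so any two such modules are
isomorphic (`IsVermaGenerator.nonempty_equiv`). The Verma module `V(μ)` is one of them as soon as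
there is another one, because the ideal defining `V(μ)` kills any primitive vector of weight `μ`
(`isVermaGenerator_vermaGenerator`); no Poincaré-Birkhoff-Witt theorem is needed. Hence
`U(𝔟) x(b, 0) ≅ V(λ)` and `U(𝔞) x(b, 0) ≅ V(μ)` in all cases. Submodules of such a module are
compatible with the weight decomposition, so `V(μ)` is simple unless `μ = n` is a natural number
(`IsVermaGenerator.isIrreducible`), and for `μ = n` its only nontrivial proper submodule is spanned
by the `fᵏ v` with `k > n` (`IsVermaGenerator.eq_lowerSpan`).

*Outer tensor product.* The vectors `f_Bⁱ f_Aʲ x(b, 0)` have distinct weights, hence are linearly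
independent, and `f_Bⁱ s ⊗ f_Aʲ τ ↦ f_Bⁱ f_Aʲ x(b, 0)` is the required isomorphism
(`exists_tensor_equiv_lieSpan`).
-/

namespace HoweSl

open LieModule Module

/-! ### Modules freely generated by the lowering operator of an `sl₂`-triple -/

section Sl2

variable {L : Type*} [LieRing L] [LieAlgebra ℂ L] {h e f : L} {t : IsSl2Triple h e f}
  {M : Type*} [AddCommGroup M] [Module ℂ M] [LieRingModule L M] [LieModule ℂ L M]
  {M' : Type*} [AddCommGroup M'] [Module ℂ M'] [LieRingModule L M'] [LieModule ℂ L M']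
  {v : M} {w : M'} {μ : ℂ}

/-- The vectors `fᵏ v` have pairwise distinct weights, so they are linearly independent as soon as
they do not vanish. -/
theorem linearIndependent_pow_lower (P : t.HasPrimitiveVectorWith v μ)
    (hf : ∀ k : ℕ, (toEnd ℂ L M f ^ k) v ≠ 0) :
    LinearIndependent ℂ fun k : ℕ => (toEnd ℂ L M f ^ k) v := by
  refine Module.End.eigenvectors_linearIndependent' (toEnd ℂ L M h) (fun k : ℕ => μ - 2 * k) ?_ _
    fun k => ⟨Module.End.mem_eigenspace_iff.mpr (P.lie_h_pow_toEnd_f k), hf k⟩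
  intro k l hkl
  simpa using hkl

theorem raise_pow_succ_lower (P : t.HasPrimitiveVectorWith v μ) (k : ℕ) :
    ⁅e, (toEnd ℂ L M f ^ (k + 1)) v⁆ =
      (((k : ℂ) + 1) * (μ - k)) • (toEnd ℂ L M f ^ k) v :=
  P.lie_e_pow_succ_toEnd_f k

/-- For a weight that is not a natural number, `eᵏ fᵏ v` is a nonzero multiple of `v`. -/
theorem pow_lower_ne_zero (P : t.HasPrimitiveVectorWith v μ) (hμ : ∀ n : ℕ, μ ≠ n) (k : ℕ) :
    (toEnd ℂ L M f ^ k) v ≠ 0 := by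
  induction k with
  | zero => simpa using P.ne_zero
  | succ k ih =>
    intro h0
    have := raise_pow_succ_lower P k
    rw [h0, lie_zero, eq_comm, smul_eq_zero] at this
    refine this.elim (mul_ne_zero (Nat.cast_add_one_ne_zero k) ?_) ih
    exact sub_ne_zero.mpr (hμ k)

theorem lie_mem_of_triple (ht : ∀ x : L, ∃ a b c : ℂ, x = a • e + b • f + c • h)
    {S : Submodule ℂ M} {m : M} (he : ⁅e, m⁆ ∈ S) (hf : ⁅f, m⁆ ∈ S) (hh : ⁅h, m⁆ ∈ S) (x : L) :
    ⁅x, m⁆ ∈ S := by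
  obtain ⟨a, b, c, rfl⟩ := ht x
  simp only [add_lie, smul_lie]
  exact add_mem (add_mem (S.smul_mem _ he) (S.smul_mem _ hf)) (S.smul_mem _ hh)

/-- The action on `fᵏ v` only involves `fᵏ⁺¹ v`, `fᵏ v` and `fᵏ⁻¹ v`, the last with a coefficient
that vanishes if `μ = k - 1`. -/
theorem lie_pow_lower_mem (ht : ∀ x : L, ∃ a b c : ℂ, x = a • e + b • f + c • h)
    (P : t.HasPrimitiveVectorWith v μ) {S : Submodule ℂ M} (k : ℕ)
    (h1 : (toEnd ℂ L M f ^ (k + 1)) v ∈ S) (h0 : (toEnd ℂ L M f ^ k) v ∈ S)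
    (hm : ∀ j, k = j + 1 → (toEnd ℂ L M f ^ j) v ∈ S ∨ μ = j) (x : L) :
    ⁅x, (toEnd ℂ L M f ^ k) v⁆ ∈ S := by
  refine lie_mem_of_triple ht ?_ ?_ ?_ x
  · cases k with
    | zero => simp [P.lie_e]
    | succ j =>
      rw [raise_pow_succ_lower P]
      rcases hm j rfl with hj | hj
      · exact S.smul_mem _ hj
      · simp [hj]
  · rw [P.lie_f_pow_toEnd_f]; exact h1
  · rw [P.lie_h_pow_toEnd_f]; exact S.smul_mem _ h0

/-- The span of the vectors `fᵏ v` with `k ≥ m`, as a submodule: it is stable because `m = 0`, or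
because `μ = m - 1` and hence `e fᵐ v = 0`. -/
def lowerSpan (ht : ∀ x : L, ∃ a b c : ℂ, x = a • e + b • f + c • h)
    (P : t.HasPrimitiveVectorWith v μ) (m : ℕ) (hm : ∀ j : ℕ, m = j + 1 → μ = j) :
    LieSubmodule ℂ L M where
  __ := Submodule.span ℂ ((fun k : ℕ => (toEnd ℂ L M f ^ k) v) '' Set.Ici m)
  lie_mem := by
    intro x y hy
    change y ∈ Submodule.span ℂ _ at hy
    change ⁅x, y⁆ ∈ Submodule.span ℂ _
    have hmem : ∀ k, m ≤ k → (toEnd ℂ L M f ^ k) v ∈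
        Submodule.span ℂ ((fun k : ℕ => (toEnd ℂ L M f ^ k) v) '' Set.Ici m) :=
      fun k hk => Submodule.subset_span ⟨k, hk, rfl⟩
    induction hy using Submodule.span_induction with
    | zero => rw [lie_zero]; exact zero_mem _
    | add y z _ _ hy hz => rw [lie_add]; exact add_mem hy hz
    | smul c y _ hy => rw [lie_smul]; exact Submodule.smul_mem _ c hy
    | mem y hy =>
      obtain ⟨k, hk, rfl⟩ := hy
      rw [Set.mem_Ici] at hk
      refine lie_pow_lower_mem ht P k (hmem _ (by omega)) (hmem k hk) (fun j hj => ?_) x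
      rcases hk.eq_or_lt with h | h
      · exact Or.inr (hm j (h.trans hj))
      · exact Or.inl (hmem j (by omega))

theorem pow_lower_mem (N : LieSubmodule ℂ L M) {j k : ℕ} (hjk : j ≤ k)
    (hj : (toEnd ℂ L M f ^ j) v ∈ N) : (toEnd ℂ L M f ^ k) v ∈ N := by
  induction k, hjk using Nat.le_induction with
  | base => exact hj
  | succ k _ ih => rw [pow_succ', Module.End.mul_apply]; exact N.lie_mem ih

theorem lowerSpan_zero_eq_top (ht : ∀ x : L, ∃ a b c : ℂ, x = a • e + b • f + c • h)
    (P : t.HasPrimitiveVectorWith v μ) (hs : LieSubmodule.lieSpan ℂ L {v} = ⊤) :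
    lowerSpan ht P 0 (by simp) = ⊤ := by
  rw [eq_top_iff, ← hs, LieSubmodule.lieSpan_le, Set.singleton_subset_iff]
  exact Submodule.subset_span ⟨0, by simp⟩

/-- If `w` is primitive of the same weight as the generator `v`, then a linear map with
`fᵏ v ↦ fᵏ w` for all `k` commutes with the action. -/
theorem map_lie_of_pow_lower (ht : ∀ x : L, ∃ a b c : ℂ, x = a • e + b • f + c • h)
    (P : t.HasPrimitiveVectorWith v μ) (hs : LieSubmodule.lieSpan ℂ L {v} = ⊤)
    (P' : t.HasPrimitiveVectorWith w μ) (g : M →ₗ[ℂ] M')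
    (hg : ∀ k : ℕ, g ((toEnd ℂ L M f ^ k) v) = (toEnd ℂ L M' f ^ k) w) (x : L) (m : M) :
    g ⁅x, m⁆ = ⁅x, g m⁆ := by
  have hm : m ∈ lowerSpan ht P 0 (by simp) := by
    rw [lowerSpan_zero_eq_top ht P hs]; exact LieSubmodule.mem_top m
  change m ∈ Submodule.span ℂ _ at hm
  induction hm using Submodule.span_induction with
  | zero => simp
  | add y z _ _ hy hz => simp only [lie_add, map_add, hy, hz]
  | smul c y _ hy => simp only [lie_smul, map_smul, hy]
  | mem y hy =>
    obtain ⟨k, -, rfl⟩ := hy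
    obtain ⟨a, b, c, rfl⟩ := ht x
    simp only [add_lie, smul_lie, map_add, map_smul, hg, P.lie_f_pow_toEnd_f,
      P.lie_h_pow_toEnd_f, P'.lie_f_pow_toEnd_f, P'.lie_h_pow_toEnd_f]
    cases k with
    | zero => simp [P.lie_e, P'.lie_e]
    | succ k => rw [raise_pow_succ_lower P, raise_pow_succ_lower P', map_smul, hg]

variable (t) in
/-- `v` is a primitive vector of weight `μ` that generates `M` and satisfies `fᵏ v ≠ 0` for all
`k`. If the triple spans `L`, this characterizes the Verma module of highest weight `μ` with its
canonical generator. -/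
structure IsVermaGenerator (v : M) (μ : ℂ) : Prop where
  primitive : t.HasPrimitiveVectorWith v μ
  pow_ne_zero : ∀ k : ℕ, (toEnd ℂ L M f ^ k) v ≠ 0
  lieSpan_eq_top : LieSubmodule.lieSpan ℂ L {v} = ⊤

namespace IsVermaGenerator

/-- The basis `v, f v, f² v, …`. -/
noncomputable def basis (ht : ∀ x : L, ∃ a b c : ℂ, x = a • e + b • f + c • h)
    (V : IsVermaGenerator t v μ) : Basis ℕ ℂ M :=
  Basis.mk (linearIndependent_pow_lower V.primitive V.pow_ne_zero) (by
    have := congrArg LieSubmodule.toSubmodule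
      (lowerSpan_zero_eq_top ht V.primitive V.lieSpan_eq_top)
    change Submodule.span ℂ _ = ⊤ at this
    rw [← this, show Set.Ici (0 : ℕ) = Set.univ by ext; simp, Set.image_univ])

variable (ht : ∀ x : L, ∃ a b c : ℂ, x = a • e + b • f + c • h)

@[simp] theorem basis_apply (V : IsVermaGenerator t v μ) (k : ℕ) :
    V.basis ht k = (toEnd ℂ L M f ^ k) v := by simp [basis]

include ht

theorem nonempty_equiv (V : IsVermaGenerator t v μ) (V' : IsVermaGenerator t w μ) :
    Nonempty (M ≃ₗ⁅ℂ, L⁆ M') := by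
  let g := (V.basis ht).equiv (V'.basis ht) (Equiv.refl ℕ)
  have hg : ∀ k : ℕ, g ((toEnd ℂ L M f ^ k) v) = (toEnd ℂ L M' f ^ k) w := by
    intro k
    rw [← V.basis_apply ht, ← V'.basis_apply ht, Basis.equiv_apply, Equiv.refl_apply]
  exact ⟨{ g with
    map_lie' := fun {x m} =>
      map_lie_of_pow_lower ht V.primitive V.lieSpan_eq_top V'.primitive g.toLinearMap hg x m }⟩

omit ht in
/-- A submodule that contains a combination of vectors of distinct weights contains each term. -/
theorem smul_mem_of_sum_mem (V : IsVermaGenerator t v μ) (N : LieSubmodule ℂ L M) (s : Finset ℕ)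
    (c : ℕ → ℂ) (hs : ∑ k ∈ s, c k • (toEnd ℂ L M f ^ k) v ∈ N) :
    ∀ k ∈ s, c k • (toEnd ℂ L M f ^ k) v ∈ N := by
  induction s using Finset.induction_on generalizing c with
  | empty => simp
  | insert a s ha ih =>
    have hsub : ∀ k ∈ s, c k • (toEnd ℂ L M f ^ k) v ∈ N := by
      intro k hk
      -- `h - (μ - 2a)` removes the term of index `a` and rescales the others.
      have h1 := N.sub_mem (N.lie_mem (x := h) hs) (N.smul_mem (μ - 2 * a) hs)
      have h2 := ih (fun k => 2 * ((a : ℂ) - k) * c k) (by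
        refine (congrArg (· ∈ N) ?_).mpr h1
        rw [Finset.sum_insert ha, lie_add, smul_add, lie_smul, V.primitive.lie_h_pow_toEnd_f,
          smul_comm (c a), add_sub_add_left_eq_sub, lie_sum,
          Finset.smul_sum, ← Finset.sum_sub_distrib]
        refine Finset.sum_congr rfl fun k _ => ?_
        rw [lie_smul, V.primitive.lie_h_pow_toEnd_f, smul_smul, smul_smul, ← sub_smul]
        congr 1
        ring) k hk
      have hak : (2 * ((a : ℂ) - k)) ≠ 0 := by
        refine mul_ne_zero two_ne_zero (sub_ne_zero.mpr (Nat.cast_injective.ne ?_))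
        rintro rfl
        exact ha hk
      have h3 := N.smul_mem (2 * ((a : ℂ) - k))⁻¹ h2
      rwa [smul_smul, inv_mul_cancel_left₀ hak] at h3
    intro k hk
    rcases Finset.mem_insert.mp hk with rfl | hk
    · rw [Finset.sum_insert ha] at hs
      exact (N.toSubmodule.add_mem_iff_left (N.toSubmodule.sum_mem hsub)).mp hs
    · exact hsub k hk

theorem pow_lower_mem_of_repr_ne_zero (V : IsVermaGenerator t v μ) (N : LieSubmodule ℂ L M)
    {m : M} (hm : m ∈ N) {k : ℕ} (hk : (V.basis ht).repr m k ≠ 0) :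
    (toEnd ℂ L M f ^ k) v ∈ N := by
  have h1 := (V.basis ht).linearCombination_repr m
  rw [Finsupp.linearCombination_apply, Finsupp.sum] at h1
  simp only [basis_apply] at h1
  rw [← h1] at hm
  have h2 := N.smul_mem ((V.basis ht).repr m k)⁻¹
    (V.smul_mem_of_sum_mem N _ _ hm k (Finsupp.mem_support_iff.mpr hk))
  rwa [inv_smul_smul₀ hk] at h2

theorem exists_pow_lower_mem (V : IsVermaGenerator t v μ) (N : LieSubmodule ℂ L M) (hN : N ≠ ⊥) :
    ∃ k : ℕ, (toEnd ℂ L M f ^ k) v ∈ N := by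
  obtain ⟨m, hm, h0⟩ := (Submodule.ne_bot_iff N.toSubmodule).mp (by simpa using hN)
  obtain ⟨k, hk⟩ := Finsupp.ne_iff.mp ((V.basis ht).repr.map_ne_zero_iff.mpr h0)
  exact ⟨k, V.pow_lower_mem_of_repr_ne_zero ht N hm hk⟩

omit ht in
theorem eq_top_of_mem (V : IsVermaGenerator t v μ) (N : LieSubmodule ℂ L M) (hv : v ∈ N) :
    N = ⊤ := by
  rw [eq_top_iff, ← V.lieSpan_eq_top, LieSubmodule.lieSpan_le, Set.singleton_subset_iff]
  exact hv

omit ht in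
/-- The raising operator leads from `fᵏ v` down to `fʲ v` unless it meets the weight `μ = i`, that
is, a primitive vector `fⁱ⁺¹ v`, on the way. -/
theorem pow_lower_mem_of_le (V : IsVermaGenerator t v μ) (N : LieSubmodule ℂ L M) {j k : ℕ}
    (hjk : j ≤ k) (hμ : ∀ i, j ≤ i → i < k → μ ≠ i) (hk : (toEnd ℂ L M f ^ k) v ∈ N) :
    (toEnd ℂ L M f ^ j) v ∈ N := by
  induction k, hjk using Nat.le_induction with
  | base => exact hk
  | succ k hjk ih =>
    refine ih (fun i hi hik => hμ i hi (by omega)) ?_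
    have h1 := N.lie_mem (x := e) hk
    rw [raise_pow_succ_lower V.primitive] at h1
    have hc : ((k : ℂ) + 1) * (μ - k) ≠ 0 :=
      mul_ne_zero (Nat.cast_add_one_ne_zero k) (sub_ne_zero.mpr (hμ k hjk (by omega)))
    have h2 := N.smul_mem (((k : ℂ) + 1) * (μ - k))⁻¹ h1
    rwa [inv_smul_smul₀ hc] at h2

theorem isIrreducible (V : IsVermaGenerator t v μ) (hμ : ∀ n : ℕ, μ ≠ n) :
    LieModule.IsIrreducible ℂ L M := by
  have : Nontrivial M := ⟨v, 0, V.primitive.ne_zero⟩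
  refine LieModule.IsIrreducible.mk fun N hN => ?_
  obtain ⟨k, hk⟩ := V.exists_pow_lower_mem ht N hN
  exact V.eq_top_of_mem N (V.pow_lower_mem_of_le N k.zero_le (fun i _ _ => hμ i) hk)

section NatWeight

variable {n : ℕ} (V : IsVermaGenerator t v (n : ℂ))

theorem lowerSpan_ne_bot :
    lowerSpan ht V.primitive (n + 1) (fun j hj => by simp at hj; simp [hj]) ≠ ⊥ := by
  intro h0
  refine V.pow_ne_zero (n + 1) ((LieSubmodule.eq_bot_iff _).mp h0 _ ?_)
  exact Submodule.subset_span ⟨n + 1, by simp, rfl⟩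

theorem lowerSpan_ne_top :
    lowerSpan ht V.primitive (n + 1) (fun j hj => by simp at hj; simp [hj]) ≠ ⊤ := by
  intro h0
  have h1 : v ∈ lowerSpan ht V.primitive (n + 1) (fun j hj => by simp at hj; simp [hj]) := by
    rw [h0]; exact LieSubmodule.mem_top v
  change v ∈ Submodule.span ℂ _ at h1
  have h2 := (linearIndependent_pow_lower V.primitive V.pow_ne_zero).notMem_span_image
    (s := Set.Ici (n + 1)) (x := 0) (by simp)
  exact h2 (by simpa using h1)

theorem lowerSpan_le_of_ne_bot (N : LieSubmodule ℂ L M) (hN : N ≠ ⊥) :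
    lowerSpan ht V.primitive (n + 1) (fun j hj => by simp at hj; simp [hj]) ≤ N := by
  obtain ⟨k, hk⟩ := V.exists_pow_lower_mem ht N hN
  have h1 : (toEnd ℂ L M f ^ (n + 1)) v ∈ N := by
    refine V.pow_lower_mem_of_le N (le_max_left (n + 1) k) (fun i hi _ => ?_)
      (pow_lower_mem N (le_max_right (n + 1) k) hk)
    exact Nat.cast_injective.ne (by omega)
  change Submodule.span ℂ _ ≤ N.toSubmodule
  rw [Submodule.span_le]
  rintro _ ⟨k, hk, rfl⟩
  exact pow_lower_mem N hk h1

/-- Submodules are sums of weight spaces, so a submodule not contained in the span of the `fᵏ v`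
with `k > n` contains some `fᵏ v` with `k ≤ n`, and from there the raising operator leads to `v`. -/
theorem le_lowerSpan_of_ne_top (N : LieSubmodule ℂ L M) (hN : N ≠ ⊤) :
    N ≤ lowerSpan ht V.primitive (n + 1) (fun j hj => by simp at hj; simp [hj]) := by
  intro m hm
  change m ∈ Submodule.span ℂ _
  have h1 := (V.basis ht).linearCombination_repr m
  rw [Finsupp.linearCombination_apply, Finsupp.sum] at h1
  simp only [basis_apply] at h1
  rw [← h1]
  refine Submodule.sum_mem _ fun k hk => Submodule.smul_mem _ _
    (Submodule.subset_span ⟨k, ?_, rfl⟩)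
  by_contra hkn
  rw [Set.mem_Ici] at hkn
  refine hN (V.eq_top_of_mem N ?_)
  refine V.pow_lower_mem_of_le N k.zero_le (fun i _ hi => Nat.cast_injective.ne (by omega))
    (V.pow_lower_mem_of_repr_ne_zero ht N hm (Finsupp.mem_support_iff.mp hk))

/-- For a natural number `n`, the submodules of the Verma module of highest weight `n` are `⊥`,
`⊤` and the submodule generated by `fⁿ⁺¹ v`. -/
theorem eq_lowerSpan (N : LieSubmodule ℂ L M) (hb : N ≠ ⊥) (hN : N ≠ ⊤) :
    N = lowerSpan ht V.primitive (n + 1) (fun j hj => by simp at hj; simp [hj]) :=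
  le_antisymm (V.le_lowerSpan_of_ne_top ht N hN) (V.lowerSpan_le_of_ne_bot ht N hb)

include V

theorem not_isCompl (P Q : LieSubmodule ℂ L M) (hPQ : IsCompl P Q) : P = ⊥ ∨ Q = ⊥ := by
  by_contra! hne
  refine V.lowerSpan_ne_bot ht (le_bot_iff.mp ?_)
  exact hPQ.disjoint (V.lowerSpan_le_of_ne_bot ht P hne.1) (V.lowerSpan_le_of_ne_bot ht Q hne.2)

theorem height_top : Order.height (⊤ : LieSubmodule ℂ L M) = 2 := by
  have hb := V.lowerSpan_ne_bot ht
  have ht' := V.lowerSpan_ne_top ht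
  have hc := V.eq_lowerSpan ht
  generalize lowerSpan ht V.primitive (n + 1) (fun j hj => by simp at hj; simp [hj]) = K at *
  have hK : Order.height K = 1 := by
    refine le_antisymm ?_ ?_
    · refine Order.height_le_coe_iff (n := 1) |>.mpr fun N hN => ?_
      have : N = ⊥ := by
        by_contra h0
        exact hN.ne (hc N h0 hN.ne_top)
      simp [this]
    · simpa using Order.height_add_one_le (bot_lt_iff_ne_bot.mpr hb)
  refine le_antisymm ?_ ?_
  · refine Order.height_le_coe_iff (n := 2) |>.mpr fun N hN => ?_
    by_cases h0 : N = ⊥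
    · simp [h0]
    · rw [hc N h0 hN.ne, hK]
      exact Nat.one_lt_ofNat
  · have h2 := Order.height_add_one_le (lt_top_iff_ne_top.mpr ht')
    rw [hK] at h2
    exact h2

end NatWeight

end IsVermaGenerator

/-- A primitive vector on which all powers of `f` are nonzero is a Verma generator of the submodule
that it generates. -/
theorem isVermaGenerator_lieSpan (P : t.HasPrimitiveVectorWith v μ)
    (hf : ∀ k : ℕ, (toEnd ℂ L M f ^ k) v ≠ 0) :
    IsVermaGenerator t (M := LieSubmodule.lieSpan ℂ L {v})
      ⟨v, LieSubmodule.subset_lieSpan (Set.mem_singleton v)⟩ μ := by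
  set N := LieSubmodule.lieSpan ℂ L {v}
  set u : N := ⟨v, LieSubmodule.subset_lieSpan (Set.mem_singleton v)⟩
  have hpow : ∀ k : ℕ, (((toEnd ℂ L N f ^ k) u : N) : M) = (toEnd ℂ L M f ^ k) v := by
    intro k
    induction k with
    | zero => rfl
    | succ k ih => simp [pow_succ', ih]
  refine ⟨⟨?_, ?_, ?_⟩, fun k hk => hf k ?_, ?_⟩
  · exact fun h0 => P.ne_zero (congrArg Subtype.val h0)
  · exact Subtype.ext P.lie_h
  · exact Subtype.ext P.lie_e
  · rw [← hpow, hk]; rfl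
  · rw [eq_top_iff]
    intro y _
    have h1 : N ≤ (LieSubmodule.lieSpan ℂ L {u}).map N.incl := by
      refine LieSubmodule.lieSpan_le.mpr (Set.singleton_subset_iff.mpr ?_)
      exact ⟨u, LieSubmodule.subset_lieSpan (Set.mem_singleton u), rfl⟩
    obtain ⟨z, hz, hzy⟩ := h1 y.2
    have : z = y := Subtype.ext hzy
    exact this ▸ hz

end Sl2

end HoweSl

namespace HoweSl

open LieModule Module

/-! ### Verma modules and their simple quotients -/

theorem adjoin_range_uea_ι {L : Type*} [LieRing L] [LieAlgebra ℂ L] :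
    Algebra.adjoin ℂ (Set.range (UniversalEnvelopingAlgebra.ι ℂ : L → _)) =
      (⊤ : Subalgebra ℂ (UniversalEnvelopingAlgebra ℂ L)) := by
  have hs : Function.Surjective (UniversalEnvelopingAlgebra.mkAlgHom ℂ L) :=
    RingCon.mkₐ_surjective _
  rw [← (AlgHom.range_eq_top _).mpr hs, ← Algebra.map_top, ← TensorAlgebra.adjoin_range_ι,
    AlgHom.map_adjoin, ← Set.range_comp]
  rfl

section Transfer

variable {L : Type*} [LieRing L] [LieAlgebra ℂ L] {h e f : L} {t : IsSl2Triple h e f}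
  {M : Type*} [AddCommGroup M] [Module ℂ M] [LieRingModule L M] [LieModule ℂ L M]
  {M' : Type*} [AddCommGroup M'] [Module ℂ M'] [LieRingModule L M'] [LieModule ℂ L M']
  {v : M} {μ : ℂ}

theorem IsVermaGenerator.map (V : IsVermaGenerator t v μ) (g : M →ₗ⁅ℂ, L⁆ M')
    (hg : Function.Bijective g) : IsVermaGenerator t (g v) μ := by
  have h0 : ∀ m, g m = 0 → m = 0 := fun m hm => hg.1 (hm.trans (map_zero g).symm)
  refine ⟨⟨fun h => V.primitive.ne_zero (h0 _ h), ?_, ?_⟩, fun k hk => ?_, ?_⟩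
  · rw [← LieModuleHom.map_lie, V.primitive.lie_h, map_smul]
  · rw [← LieModuleHom.map_lie, V.primitive.lie_e, map_zero]
  · rw [LieModule.toEnd_pow_apply_map] at hk
    exact V.pow_ne_zero k (h0 _ hk)
  · rw [eq_top_iff]
    intro y _
    obtain ⟨m, rfl⟩ := hg.2 y
    have hm : m ∈ (LieSubmodule.lieSpan ℂ L {g v}).comap g := by
      rw [V.eq_top_of_mem (LieSubmodule.comap g _)
        (LieSubmodule.subset_lieSpan (Set.mem_singleton _))]
      exact LieSubmodule.mem_top m
    exact hm

end Transfer

section Verma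

variable {𝔩 : Type} [LieRing 𝔩] [LieAlgebra ℂ 𝔩] {h e f : 𝔩} {t : IsSl2Triple h e f}
  {M : Type*} [AddCommGroup M] [Module ℂ M] [LieRingModule 𝔩 M] [LieModule ℂ 𝔩 M]
  {v : M} {μ : ℂ}

/-- The quotient map `U(𝔩) → V(μ)`. -/
def vermaMk (e h : 𝔩) (μ : ℂ) (u : UniversalEnvelopingAlgebra ℂ 𝔩) : Verma e h μ :=
  Submodule.Quotient.mk (p := vermaIdeal e h μ) u

/-- The canonical generator of the Verma module, the class of `1 ∈ U(𝔩)`. -/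
def vermaGenerator (e h : 𝔩) (μ : ℂ) : Verma e h μ := vermaMk e h μ 1

theorem vermaMk_surjective (e h : 𝔩) (μ : ℂ) : Function.Surjective (vermaMk e h μ) :=
  Submodule.Quotient.mk_surjective _

theorem vermaMk_eq_zero {e h : 𝔩} {μ : ℂ} {u : UniversalEnvelopingAlgebra ℂ 𝔩} :
    vermaMk e h μ u = 0 ↔ u ∈ vermaIdeal e h μ :=
  Submodule.Quotient.mk_eq_zero _

theorem smul_vermaMk (e h : 𝔩) (μ : ℂ) (u w : UniversalEnvelopingAlgebra ℂ 𝔩) :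
    u • vermaMk e h μ w = vermaMk e h μ (u * w) := rfl

theorem lie_vermaMk (e h : 𝔩) (μ : ℂ) (x : 𝔩) (u : UniversalEnvelopingAlgebra ℂ 𝔩) :
    ⁅x, vermaMk e h μ u⁆ = vermaMk e h μ (UniversalEnvelopingAlgebra.ι ℂ x * u) := rfl

theorem pow_vermaGenerator (e h : 𝔩) (μ : ℂ) (x : 𝔩) (k : ℕ) :
    (toEnd ℂ 𝔩 (Verma e h μ) x ^ k) (vermaGenerator e h μ) =
      vermaMk e h μ (UniversalEnvelopingAlgebra.ι ℂ x ^ k) := by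
  induction k with
  | zero => rw [pow_zero, pow_zero, Module.End.one_apply, vermaGenerator]
  | succ k ih =>
    rw [pow_succ', Module.End.mul_apply, ih, toEnd_apply_apply, lie_vermaMk, pow_succ']

/-- The left ideal defining the Verma module kills every vector of weight `μ` annihilated by `e`. -/
theorem lift_apply_eq_zero_of_mem_vermaIdeal (P : t.HasPrimitiveVectorWith v μ)
    {u : UniversalEnvelopingAlgebra ℂ 𝔩} (hu : u ∈ vermaIdeal e h μ) :
    UniversalEnvelopingAlgebra.lift ℂ (toEnd ℂ 𝔩 M) u v = 0 := by
  induction hu using Submodule.span_induction with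
  | zero => simp
  | add x y _ _ hx hy => rw [map_add, LinearMap.add_apply, hx, hy, add_zero]
  | smul a x _ hx => rw [smul_eq_mul, map_mul, Module.End.mul_apply, hx, map_zero]
  | mem x hx =>
    rcases hx with rfl | rfl
    · rw [UniversalEnvelopingAlgebra.lift_ι_apply, toEnd_apply_apply, P.lie_e]
    · rw [map_sub, UniversalEnvelopingAlgebra.lift_ι_apply, AlgHom.commutes,
        LinearMap.sub_apply, toEnd_apply_apply, P.lie_h, Module.algebraMap_end_apply, sub_self]

theorem pow_vermaGenerator_ne_zero (P : t.HasPrimitiveVectorWith v μ) {k : ℕ}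
    (hk : (toEnd ℂ 𝔩 M f ^ k) v ≠ 0) :
    (toEnd ℂ 𝔩 (Verma e h μ) f ^ k) (vermaGenerator e h μ) ≠ 0 := by
  rw [pow_vermaGenerator]
  intro h0
  have h1 := lift_apply_eq_zero_of_mem_vermaIdeal P (vermaMk_eq_zero.mp h0)
  rw [map_pow, UniversalEnvelopingAlgebra.lift_ι_apply] at h1
  exact hk h1

theorem lieSpan_vermaGenerator (e h : 𝔩) (μ : ℂ) :
    LieSubmodule.lieSpan ℂ 𝔩 {vermaGenerator e h μ} = ⊤ := by
  rw [eq_top_iff]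
  intro y _
  set N := LieSubmodule.lieSpan ℂ 𝔩 {vermaGenerator e h μ}
  have key : ∀ u : UniversalEnvelopingAlgebra ℂ 𝔩, ∀ z ∈ N, u • z ∈ N := by
    intro u
    have hu : u ∈ Algebra.adjoin ℂ (Set.range (UniversalEnvelopingAlgebra.ι ℂ : 𝔩 → _)) := by
      rw [adjoin_range_uea_ι]; exact Algebra.mem_top
    induction hu using Algebra.adjoin_induction with
    | mem u hu => obtain ⟨x, rfl⟩ := hu; exact fun z hz => N.lie_mem hz
    | algebraMap c => intro z hz; rw [algebraMap_smul]; exact N.smul_mem c hz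
    | add u u' _ _ hu hu' => intro z hz; rw [add_smul]; exact add_mem (hu z hz) (hu' z hz)
    | mul u u' _ _ hu hu' => intro z hz; rw [mul_smul]; exact hu _ (hu' z hz)
  obtain ⟨u, rfl⟩ := vermaMk_surjective e h μ y
  have h1 := key u _ (LieSubmodule.subset_lieSpan (Set.mem_singleton (vermaGenerator e h μ)))
  rwa [vermaGenerator, smul_vermaMk, mul_one] at h1

/-- The canonical generator of the Verma module satisfies `fᵏ ≠ 0` as soon as some module has such
a primitive vector of the same weight; the Poincaré-Birkhoff-Witt theorem is not needed. -/
theorem isVermaGenerator_vermaGenerator (P : t.HasPrimitiveVectorWith v μ)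
    (hf : ∀ k : ℕ, (toEnd ℂ 𝔩 M f ^ k) v ≠ 0) :
    IsVermaGenerator t (vermaGenerator e h μ) μ := by
  refine ⟨⟨?_, ?_, ?_⟩, fun k => pow_vermaGenerator_ne_zero P (hf k),
    lieSpan_vermaGenerator e h μ⟩
  · simpa using pow_vermaGenerator_ne_zero P (hf 0)
  · have h1 : UniversalEnvelopingAlgebra.ι ℂ h -
        algebraMap ℂ (UniversalEnvelopingAlgebra ℂ 𝔩) μ ∈ vermaIdeal e h μ :=
      Submodule.subset_span (by simp)
    have h2 : vermaMk e h μ (UniversalEnvelopingAlgebra.ι ℂ h) =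
        vermaMk e h μ (algebraMap ℂ (UniversalEnvelopingAlgebra ℂ 𝔩) μ) :=
      (Submodule.Quotient.eq (vermaIdeal e h μ)).mpr h1
    rw [vermaGenerator, lie_vermaMk, mul_one, h2,
      ← algebraMap_smul (UniversalEnvelopingAlgebra ℂ 𝔩) μ, smul_vermaMk, mul_one]
  · rw [vermaGenerator, lie_vermaMk, mul_one]
    exact vermaMk_eq_zero.mpr (Submodule.subset_span (by simp))

/-- For a weight that is not a natural number, `V(μ)` is simple, and so `L(μ) = V(μ)`. -/
theorem IsVermaGenerator.simpleHW (ht : ∀ x : 𝔩, ∃ a b c : ℂ, x = a • e + b • f + c • h)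
    (V : IsVermaGenerator t (vermaGenerator e h μ) μ) (hμ : ∀ n : ℕ, μ ≠ n) :
    IsVermaGenerator t
      (LieSubmodule.Quotient.mk (N := vermaRadical e h μ) (vermaGenerator e h μ)) μ := by
  have hirr := V.isIrreducible ht hμ
  have hrad : vermaRadical e h μ = ⊥ := by
    rw [vermaRadical, sSup_eq_bot]
    exact fun P hP => (hirr.eq_bot_or_eq_top P).resolve_right hP
  refine V.map (LieSubmodule.Quotient.mk' (vermaRadical e h μ)) ⟨?_, ?_⟩
  · intro x y hxy
    have h1 := (Submodule.Quotient.eq (vermaRadical e h μ).toSubmodule).mp hxy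
    rw [hrad] at h1
    exact sub_eq_zero.mp (by simpa using h1)
  · exact LieSubmodule.Quotient.surjective_mk' _

end Verma

/-! ### Vectors that are primitive for two commuting `sl₂`-triples -/

section Commuting

variable {L : Type*} [LieRing L] [LieAlgebra ℂ L] {𝔟 𝔞 : LieSubalgebra ℂ L}
  {N : Type*} [AddCommGroup N] [Module ℂ N] [LieRingModule L N] [LieModule ℂ L N]
  {hB eB fB : 𝔟} {tB : IsSl2Triple hB eB fB} {hA eA fA : 𝔞} {tA : IsSl2Triple hA eA fA}
  {x : N} {lam μ : ℂ}

theorem commute_toEnd (hc : ∀ (B : 𝔟) (A : 𝔞), ⁅(B : L), (A : L)⁆ = 0) (B : 𝔟) (A : 𝔞) :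
    Commute (toEnd ℂ 𝔟 N B) (toEnd ℂ 𝔞 N A) := by
  refine LinearMap.ext fun m => ?_
  change ⁅(B : L), ⁅(A : L), m⁆⁆ = ⁅(A : L), ⁅(B : L), m⁆⁆
  rw [leibniz_lie, hc, zero_lie, zero_add]

/-- Endomorphisms commuting with the action map a primitive vector to a primitive one or to `0`. -/
theorem primitive_of_commute {L : Type*} [LieRing L] [LieAlgebra ℂ L] [LieRingModule L N]
    [LieModule ℂ L N] {h e f : L} {t : IsSl2Triple h e f} (P : t.HasPrimitiveVectorWith x lam)
    (g : Module.End ℂ N) (hg : ∀ y : L, Commute (toEnd ℂ L N y) g) (h0 : g x ≠ 0) :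
    t.HasPrimitiveVectorWith (g x) lam where
  ne_zero := h0
  lie_h := by
    have := LinearMap.congr_fun (hg h).eq x
    simp only [Module.End.mul_apply, toEnd_apply_apply] at this
    rw [this, P.lie_h, map_smul]
  lie_e := by
    have := LinearMap.congr_fun (hg e).eq x
    simp only [Module.End.mul_apply, toEnd_apply_apply] at this
    rw [this, P.lie_e, map_zero]

variable (hc : ∀ (B : 𝔟) (A : 𝔞), ⁅(B : L), (A : L)⁆ = 0)
  (PB : tB.HasPrimitiveVectorWith x lam) (PA : tA.HasPrimitiveVectorWith x μ)
  (h0 : ∀ i j : ℕ, (toEnd ℂ 𝔟 N fB ^ i) ((toEnd ℂ 𝔞 N fA ^ j) x) ≠ 0)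
include hc PB PA h0

/-- The vectors `f_Bⁱ f_Aʲ x` have pairwise distinct weights, hence are linearly independent. -/
theorem linearIndependent_pow_pow : LinearIndependent ℂ fun p : ℕ × ℕ =>
    (toEnd ℂ 𝔟 N fB ^ p.1) ((toEnd ℂ 𝔞 N fA ^ p.2) x) := by
  -- The eigenvalues of `h_B + i h_A` separate the pairs of real weight shifts.
  refine Module.End.eigenvectors_linearIndependent'
    (toEnd ℂ 𝔟 N hB + Complex.I • toEnd ℂ 𝔞 N hA)
    (fun p : ℕ × ℕ => (lam - 2 * p.1) + Complex.I * (μ - 2 * p.2)) ?_ _ fun p => ⟨?_, h0 p.1 p.2⟩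
  · rintro ⟨i, j⟩ ⟨k, l⟩ hkl
    have h1 : (i : ℂ) + Complex.I * j = k + Complex.I * l := by
      simp only at hkl
      linear_combination -hkl / 2
    have hre := congrArg Complex.re h1
    have him := congrArg Complex.im h1
    simp at hre him
    exact Prod.ext hre him
  · have hA0 : (toEnd ℂ 𝔞 N fA ^ p.2) x ≠ 0 := by simpa using h0 0 p.2
    have hB0 : (toEnd ℂ 𝔟 N fB ^ p.1) x ≠ 0 := by simpa using h0 p.1 0
    have eB := (primitive_of_commute PB _ (fun y => (commute_toEnd hc y fA).pow_right p.2)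
      hA0).lie_h_pow_toEnd_f p.1
    have eA := (primitive_of_commute PA _ (fun y => ((commute_toEnd hc fB y).symm.pow_right p.1))
      hB0).lie_h_pow_toEnd_f p.2
    have hcomm : (toEnd ℂ 𝔞 N fA ^ p.2) ((toEnd ℂ 𝔟 N fB ^ p.1) x) =
        (toEnd ℂ 𝔟 N fB ^ p.1) ((toEnd ℂ 𝔞 N fA ^ p.2) x) :=
      LinearMap.congr_fun ((commute_toEnd hc fB fA).pow_pow p.1 p.2).symm.eq x
    rw [hcomm] at eA
    rw [Module.End.mem_eigenspace_iff, LinearMap.add_apply, LinearMap.smul_apply,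
      toEnd_apply_apply, toEnd_apply_apply, eB, eA, smul_smul, ← add_smul]

/-- The module generated by `x` over `𝔟 + 𝔞` is the outer tensor product of the modules with Verma
generators of the weights of `x`, via `f_Bⁱ s ⊗ f_Aʲ τ ↦ f_Bⁱ f_Aʲ x`. -/
theorem exists_tensor_equiv_lieSpan
    (htB : ∀ x : 𝔟, ∃ a b c : ℂ, x = a • eB + b • fB + c • hB)
    (htA : ∀ x : 𝔞, ∃ a b c : ℂ, x = a • eA + b • fA + c • hA)
    {S : Type*} [AddCommGroup S] [Module ℂ S] [LieRingModule 𝔟 S] [LieModule ℂ 𝔟 S]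
    {T : Type*} [AddCommGroup T] [Module ℂ T] [LieRingModule 𝔞 T] [LieModule ℂ 𝔞 T]
    {s : S} (VS : IsVermaGenerator tB s lam) {τ : T} (VT : IsVermaGenerator tA τ μ) :
    ∃ φ : (S ⊗[ℂ] T) ≃ₗ[ℂ] LieSubmodule.lieSpan ℂ (𝔟 ⊔ 𝔞 : LieSubalgebra ℂ L) {x},
      (∀ (B : 𝔟) (s : S) (τ : T),
        (φ (⁅B, s⁆ ⊗ₜ[ℂ] τ) : N) = ⁅B, (φ (s ⊗ₜ[ℂ] τ) : N)⁆) ∧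
      (∀ (A : 𝔞) (s : S) (τ : T),
        (φ (s ⊗ₜ[ℂ] ⁅A, τ⁆) : N) = ⁅A, (φ (s ⊗ₜ[ℂ] τ) : N)⁆) := by
  have hA0 : ∀ j, (toEnd ℂ 𝔞 N fA ^ j) x ≠ 0 := fun j => by simpa using h0 0 j
  have hB0 : ∀ i, (toEnd ℂ 𝔟 N fB ^ i) x ≠ 0 := fun i => by simpa using h0 i 0
  have PB' := fun j => primitive_of_commute PB _
    (fun y => (commute_toEnd hc y fA).pow_right j) (hA0 j)
  have PA' := fun i => primitive_of_commute PA _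
    (fun y => ((commute_toEnd hc fB y).symm.pow_right i)) (hB0 i)
  have hcomm : ∀ i j, (toEnd ℂ 𝔞 N fA ^ j) ((toEnd ℂ 𝔟 N fB ^ i) x) =
      (toEnd ℂ 𝔟 N fB ^ i) ((toEnd ℂ 𝔞 N fA ^ j) x) := fun i j =>
    LinearMap.congr_fun ((commute_toEnd hc fB fA).pow_pow i j).symm.eq x
  let bS := VS.basis htB
  let bT := VT.basis htA
  let Φ : (S ⊗[ℂ] T) →ₗ[ℂ] N := (bS.tensorProduct bT).constr ℂ fun p : ℕ × ℕ =>
    (toEnd ℂ 𝔟 N fB ^ p.1) ((toEnd ℂ 𝔞 N fA ^ p.2) x)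
  have hΦ : ∀ i j, Φ ((toEnd ℂ 𝔟 S fB ^ i) s ⊗ₜ (toEnd ℂ 𝔞 T fA ^ j) τ) =
      (toEnd ℂ 𝔟 N fB ^ i) ((toEnd ℂ 𝔞 N fA ^ j) x) := by
    intro i j
    rw [← VS.basis_apply htB, ← VT.basis_apply htA, ← Basis.tensorProduct_apply,
      Basis.constr_basis]
  have hinj : Function.Injective Φ :=
    Basis.injective_constr_of_linearIndependent _ (linearIndependent_pow_pow hc PB PA h0)
  have hΦB : ∀ (B : 𝔟) (s' : S) (τ' : T), Φ (⁅B, s'⁆ ⊗ₜ τ') = ⁅B, Φ (s' ⊗ₜ τ')⁆ := by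
    intro B s' τ'
    have : Φ ∘ₗ TensorProduct.mk ℂ S T ⁅B, s'⁆ =
        toEnd ℂ 𝔟 N B ∘ₗ Φ ∘ₗ TensorProduct.mk ℂ S T s' := by
      refine bT.ext fun j => ?_
      exact map_lie_of_pow_lower htB VS.primitive VS.lieSpan_eq_top (PB' j)
        (Φ ∘ₗ (TensorProduct.mk ℂ S T).flip (bT j)) (fun i => by simp [bT, hΦ]) B s'
    exact LinearMap.congr_fun this τ'
  have hΦA : ∀ (A : 𝔞) (s' : S) (τ' : T), Φ (s' ⊗ₜ ⁅A, τ'⁆) = ⁅A, Φ (s' ⊗ₜ τ')⁆ := by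
    intro A s' τ'
    have : Φ ∘ₗ (TensorProduct.mk ℂ S T).flip ⁅A, τ'⁆ =
        toEnd ℂ 𝔞 N A ∘ₗ Φ ∘ₗ (TensorProduct.mk ℂ S T).flip τ' := by
      refine bS.ext fun i => ?_
      exact map_lie_of_pow_lower htA VT.primitive VT.lieSpan_eq_top (PA' i)
        (Φ ∘ₗ TensorProduct.mk ℂ S T (bS i)) (fun j => by simp [bS, hΦ, hcomm]) A τ'
    exact LinearMap.congr_fun this s'
  -- The range of `Φ` is stable under a subalgebra that contains `𝔟` and `𝔞`.
  let K : LieSubalgebra ℂ L :=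
    { carrier := {y | ∀ m ∈ LinearMap.range Φ, ⁅y, m⁆ ∈ LinearMap.range Φ}
      add_mem' := fun {y z} hy hz m hm => by
        rw [add_lie]; exact add_mem (hy m hm) (hz m hm)
      zero_mem' := fun m _ => by rw [zero_lie]; exact zero_mem _
      smul_mem' := fun c y hy m hm => by
        rw [smul_lie]; exact Submodule.smul_mem _ c (hy m hm)
      lie_mem' := fun {y z} hy hz m hm => by
        rw [lie_lie]; exact sub_mem (hy _ (hz m hm)) (hz _ (hy m hm)) }
  have hBK : 𝔟 ≤ K := by
    rintro B hB _ ⟨z, rfl⟩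
    induction z using TensorProduct.induction_on with
    | zero => simp
    | add y z hy hz => rw [map_add, lie_add]; exact add_mem hy hz
    | tmul s' τ' => exact ⟨_, hΦB ⟨B, hB⟩ s' τ'⟩
  have hAK : 𝔞 ≤ K := by
    rintro A hA _ ⟨z, rfl⟩
    induction z using TensorProduct.induction_on with
    | zero => simp
    | add y z hy hz => rw [map_add, lie_add]; exact add_mem hy hz
    | tmul s' τ' => exact ⟨_, hΦA ⟨A, hA⟩ s' τ'⟩
  let R : LieSubmodule ℂ (𝔟 ⊔ 𝔞 : LieSubalgebra ℂ L) N :=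
    { LinearMap.range Φ with
      lie_mem := fun {y m} hm => (sup_le hBK hAK) y.2 m hm }
  set G := LieSubmodule.lieSpan ℂ (𝔟 ⊔ 𝔞 : LieSubalgebra ℂ L) {x}
  have hxG : x ∈ G := LieSubmodule.subset_lieSpan (Set.mem_singleton x)
  have hGR : G ≤ R :=
    LieSubmodule.lieSpan_le.mpr (Set.singleton_subset_iff.mpr ⟨s ⊗ₜ τ, by simpa using hΦ 0 0⟩)
  have hRG : LinearMap.range Φ ≤ G.toSubmodule := by
    rw [Basis.constr_range, Submodule.span_le]
    rintro _ ⟨⟨i, j⟩, rfl⟩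
    have h1 : ∀ j, (toEnd ℂ 𝔞 N fA ^ j) x ∈ G := by
      intro j
      induction j with
      | zero => exact hxG
      | succ j ih =>
        rw [pow_succ', Module.End.mul_apply]
        exact G.lie_mem (x := ⟨(fA : L), (le_sup_right : 𝔞 ≤ 𝔟 ⊔ 𝔞) fA.2⟩) ih
    change (toEnd ℂ 𝔟 N fB ^ i) ((toEnd ℂ 𝔞 N fA ^ j) x) ∈ G
    induction i with
    | zero => exact h1 j
    | succ i ih =>
      rw [pow_succ', Module.End.mul_apply]
      exact G.lie_mem (x := ⟨(fB : L), (le_sup_left : 𝔟 ≤ 𝔟 ⊔ 𝔞) fB.2⟩) ih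
  refine ⟨(LinearEquiv.ofInjective Φ hinj).trans
    (LinearEquiv.ofEq _ G.toSubmodule (le_antisymm hRG hGR)), fun B s' τ' => ?_, fun A s' τ' => ?_⟩
  · exact hΦB B s' τ'
  · exact hΦA A s' τ'

end Commuting

end HoweSl

namespace HoweSl

open LieModule Module

/-! ### Coefficients of monomials -/

section Coefficients

variable {ι : Type}

/-- The coefficient of the basis vector `x(c)`, as a linear form. -/
def coeff (c : ι → ℂ) : Mono ι →ₗ[ℂ] ℂ := Finsupp.lapply (R := ℂ) c

open Classical in
theorem coeff_mono (c b : ι → ℂ) : coeff c (mono b) = if b = c then 1 else 0 :=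
  Finsupp.single_apply

theorem mono_ext_scalar {f g : Mono ι →ₗ[ℂ] ℂ} (h : ∀ b, f (mono b) = g (mono b)) : f = g :=
  Finsupp.lhom_ext' fun b => LinearMap.ext_ring (h b)

variable [DecidableEq ι]

theorem coeff_opQ (i : ι) (c : ι → ℂ) (m : Mono ι) :
    coeff c (opQ i m) = qCoeff (c i - 1) * coeff (c - Pi.single i 1) m := by
  have : coeff c ∘ₗ opQ i = qCoeff (c i - 1) • coeff (c - Pi.single i 1) := by
    refine mono_ext_scalar fun b => ?_
    simp only [LinearMap.comp_apply, LinearMap.smul_apply, opQ_mono, map_smul, coeff_mono,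
      smul_eq_mul]
    by_cases h : b + Pi.single i 1 = c
    · simp [← h]
    · simp [h, eq_sub_iff_add_eq]
  exact LinearMap.congr_fun this m

theorem coeff_opP (i : ι) (c : ι → ℂ) (m : Mono ι) :
    coeff c (opP i m) = pCoeff (c i + 1) * coeff (c + Pi.single i 1) m := by
  have : coeff c ∘ₗ opP i = pCoeff (c i + 1) • coeff (c + Pi.single i 1) := by
    refine mono_ext_scalar fun b => ?_
    simp only [LinearMap.comp_apply, LinearMap.smul_apply, opP_mono, map_smul, coeff_mono,
      smul_eq_mul]
    by_cases h : b - Pi.single i 1 = c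
    · simp [← h]
    · simp [h, ← sub_eq_iff_eq_add]
  exact LinearMap.congr_fun this m

theorem qCoeff_neg_one : qCoeff (-1) = 0 := by simp [qCoeff, isNegInt_neg_one]

theorem pCoeff_zero : pCoeff 0 = 0 := by simp [pCoeff, not_isNegInt_zero]

theorem opQ_opP_mono_self (i : ι) (c : ι → ℂ) : opQ i (opP i (mono c)) = c i • mono c := by
  have h : pCoeff (c i) * qCoeff (c i - 1) = c i := by
    by_cases h : IsNegInt (c i)
    · simp [pCoeff, qCoeff, h, isNegInt_sub_one h]
    · by_cases h0 : c i = 0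
      · simp [h0, pCoeff_zero]
      · simp [pCoeff, qCoeff, h, isNegInt_sub_one_iff h0]
  rw [opP_mono, map_smul, opQ_mono, smul_smul, Pi.sub_apply, Pi.single_eq_same, h,
    sub_add_cancel]

theorem opQ_opP_mono_eq_zero {i j : ι} (hij : i ≠ j) {c : ι → ℂ} (h : c j = 0 ∨ c i = -1) :
    opQ i (opP j (mono c)) = 0 := by
  rw [opP_mono, map_smul, opQ_mono, smul_smul, Pi.sub_apply, Pi.single_eq_of_ne hij, sub_zero]
  rcases h with h | h <;> simp [h, pCoeff_zero, qCoeff_neg_one]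

/-- On exponents with `k`-th entry `0`, the operator `q_k p_l` contributes nothing to the
coefficients, since `q_k` kills the exponent `-1`. -/
theorem coeff_move {a b k : ι} (l : ι) (hab : a ≠ b) (hka : k ≠ a) (hkb : k ≠ b) {c : ι → ℂ}
    (hc : c k = 0) (m : Mono ι) :
    coeff (c - Pi.single b 1 + Pi.single a 1) ((opQ a * opP b + opQ k * opP l) m) =
      qCoeff (c a) * pCoeff (c b) * coeff c m := by
  simp only [LinearMap.add_apply, Module.End.mul_apply, map_add, coeff_opQ, coeff_opP]
  simp [hc, hka, hkb, hab, hab.symm, qCoeff_neg_one, mul_assoc]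

/-- If `c_k = 0`, `c_b = -1` and no `c_a + j` is a negative integer, the coefficient of
`x(c - j ε_b + j ε_a)` in the `j`-th power of the operator applied to `x(c)` is `1`. -/
theorem pow_move_ne_zero {a b k : ι} (l : ι) (hab : a ≠ b) (hka : k ≠ a) (hkb : k ≠ b)
    {c : ι → ℂ} (hck : c k = 0) (hcb : c b = -1) (hca : ∀ j : ℕ, ¬ IsNegInt (c a + j)) (j : ℕ) :
    ((opQ a * opP b + opQ k * opP l) ^ j) (mono c) ≠ 0 := by
  have key : coeff (c - Pi.single b (j : ℂ) + Pi.single a (j : ℂ))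
      (((opQ a * opP b + opQ k * opP l) ^ j) (mono c)) = 1 := by
    induction j with
    | zero => simp [coeff_mono]
    | succ j ih =>
      have hs : c - Pi.single b ((j + 1 : ℕ) : ℂ) + Pi.single a ((j + 1 : ℕ) : ℂ) =
          (c - Pi.single b (j : ℂ) + Pi.single a (j : ℂ)) - Pi.single b 1 + Pi.single a 1 := by
        rw [Nat.cast_add, Nat.cast_one, Pi.single_add, Pi.single_add]
        abel
      have hneg : IsNegInt (-1 - (j : ℂ)) := ⟨j, by ring⟩
      rw [hs, pow_succ', Module.End.mul_apply, coeff_move l hab hka hkb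
        (by simp [hka, hkb, hck]), ih]
      simp [hab, hab.symm, hcb, qCoeff, pCoeff, hca j, hneg]
  intro h0
  rw [h0, map_zero] at key
  exact zero_ne_one key

end Coefficients

/-! ### The two commuting `sl₂`-triples in `sl₄` -/

section Triples

/-- The lowering element `diag(E₂₁, E₂₁)` of `𝔟`. -/
def lowerB : algB 2 :=
  ⟨diagEmb 2 (LieAlgebra.SpecialLinear.single 1 0 (by decide) 1), LieHom.mem_range_self _ _⟩

/-- The lowering element `X` of `𝔞`. -/
def lowerA (n : ℕ) : algA n := ⟨elX n, LieSubalgebra.subset_lieSpan (by simp)⟩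

theorem lie_elX_elY (n : ℕ) : ⁅elY n, elX n⁆ = elH n := by
  apply Subtype.ext
  simp [elX, elY, elH, LieRing.of_associative_ring_bracket, Matrix.fromBlocks_multiply,
    sub_eq_add_neg, Matrix.fromBlocks_neg, Matrix.fromBlocks_add]

theorem lie_elH_elY (n : ℕ) : ⁅elH n, elY n⁆ = 2 • elY n := by
  apply Subtype.ext
  simp [elY, elH, LieRing.of_associative_ring_bracket, Matrix.fromBlocks_multiply,
    sub_eq_add_neg, Matrix.fromBlocks_neg, Matrix.fromBlocks_add, two_smul]

theorem lie_elH_elX (n : ℕ) : ⁅elH n, elX n⁆ = -(2 • elX n) := by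
  apply Subtype.ext
  simp [elX, elH, LieRing.of_associative_ring_bracket, Matrix.fromBlocks_multiply,
    sub_eq_add_neg, Matrix.fromBlocks_neg, Matrix.fromBlocks_add, two_smul]

theorem elH_ne_zero : elH 2 ≠ 0 := by
  intro h
  have := congrFun (congrFun (congrArg Subtype.val h) (Sum.inl 0)) (Sum.inl 0)
  simp [elH] at this

theorem tripleA : IsSl2Triple (cartanA 2) (raiseA 2) (lowerA 2) where
  h_ne_zero h := elH_ne_zero (congrArg Subtype.val h)
  lie_e_f := Subtype.ext (lie_elX_elY 2)
  lie_h_e_nsmul := Subtype.ext (lie_elH_elY 2)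
  lie_h_f_nsmul := Subtype.ext (lie_elH_elX 2)

theorem exists_smul_of_algA (x : algA 2) :
    ∃ a b c : ℂ, x = a • raiseA 2 + b • lowerA 2 + c • cartanA 2 := by
  have hle : algA 2 ≤ (tripleA.toLieSubalgebra ℂ).map (algA 2).incl := by
    refine LieSubalgebra.lieSpan_le.mpr ?_
    rintro _ (rfl | rfl | rfl)
    · exact ⟨lowerA 2, Submodule.subset_span (by simp), rfl⟩
    · exact ⟨cartanA 2, Submodule.subset_span (by simp), rfl⟩
    · exact ⟨raiseA 2, Submodule.subset_span (by simp), rfl⟩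
  obtain ⟨y, hy, hyx⟩ := hle x.2
  obtain rfl : y = x := Subtype.ext hyx
  obtain ⟨a, b, c, h⟩ := IsSl2Triple.mem_toLieSubalgebra_iff.mp hy
  exact ⟨a, b, c, by rw [h, tripleA.lie_e_f]⟩

theorem coe_raiseB : ((raiseB : slTwo 2) : Matrix (Fin 2 ⊕ Fin 2) (Fin 2 ⊕ Fin 2) ℂ) =
    Matrix.fromBlocks (Matrix.single 0 1 1) 0 0 (Matrix.single 0 1 1) := rfl

theorem coe_lowerB : ((lowerB : slTwo 2) : Matrix (Fin 2 ⊕ Fin 2) (Fin 2 ⊕ Fin 2) ℂ) =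
    Matrix.fromBlocks (Matrix.single 1 0 1) 0 0 (Matrix.single 1 0 1) := rfl

theorem coe_cartanB : ((cartanB : slTwo 2) : Matrix (Fin 2 ⊕ Fin 2) (Fin 2 ⊕ Fin 2) ℂ) =
    Matrix.fromBlocks (Matrix.single 0 0 1 - Matrix.single 1 1 1) 0 0
      (Matrix.single 0 0 1 - Matrix.single 1 1 1) := rfl

theorem tripleB : IsSl2Triple cartanB raiseB lowerB where
  h_ne_zero h := by
    have h1 : ((cartanB : slTwo 2) : Matrix (Fin 2 ⊕ Fin 2) (Fin 2 ⊕ Fin 2) ℂ) = 0 := by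
      rw [h]; rfl
    rw [coe_cartanB] at h1
    simpa using congrFun (congrFun h1 (Sum.inl 0)) (Sum.inl 0)
  lie_e_f := by
    refine Subtype.ext (Subtype.ext ?_)
    simp [coe_raiseB, coe_lowerB, coe_cartanB, LieRing.of_associative_ring_bracket,
      Matrix.fromBlocks_multiply, sub_eq_add_neg, Matrix.fromBlocks_neg, Matrix.fromBlocks_add]
  lie_h_e_nsmul := by
    refine Subtype.ext (Subtype.ext ?_)
    simp [coe_raiseB, coe_cartanB, LieRing.of_associative_ring_bracket, two_smul, add_mul, mul_add,
      Matrix.fromBlocks_multiply, sub_eq_add_neg, Matrix.fromBlocks_neg, Matrix.fromBlocks_add]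
  lie_h_f_nsmul := by
    refine Subtype.ext (Subtype.ext ?_)
    simp [coe_lowerB, coe_cartanB, LieRing.of_associative_ring_bracket, two_smul, add_mul, mul_add,
      Matrix.fromBlocks_multiply, sub_eq_add_neg, Matrix.fromBlocks_neg, Matrix.fromBlocks_add]

theorem exists_smul_of_algB (x : algB 2) :
    ∃ a b c : ℂ, x = a • raiseB + b • lowerB + c • cartanB := by
  obtain ⟨_, A, rfl⟩ := x
  have htr : A.1 0 0 + A.1 1 1 = 0 := by
    have h : Matrix.trace A.1 = 0 := A.2
    rwa [Matrix.trace_fin_two] at h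
  have hA : A.1 = A.1 0 1 • Matrix.single 0 1 1 + A.1 1 0 • Matrix.single 1 0 1 +
      A.1 0 0 • (Matrix.single 0 0 1 - Matrix.single 1 1 (1 : ℂ)) := by
    ext i j
    fin_cases i <;> fin_cases j <;> simp
    linear_combination htr
  refine ⟨A.1 0 1, A.1 1 0, A.1 0 0, Subtype.ext (Subtype.ext ?_)⟩
  change Matrix.fromBlocks A.1 0 0 A.1 = A.1 0 1 • (raiseB : slTwo 2).1 +
    A.1 1 0 • (lowerB : slTwo 2).1 + A.1 0 0 • (cartanB : slTwo 2).1
  simp only [coe_raiseB, coe_lowerB, coe_cartanB, Matrix.fromBlocks_smul, Matrix.fromBlocks_add,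
    smul_zero, add_zero, ← hA]

theorem lie_algB_algA (B : algB 2) (A : algA 2) : ⁅(B : slTwo 2), (A : slTwo 2)⁆ = 0 := by
  obtain ⟨_, C, rfl⟩ := B
  obtain ⟨a, b, c, rfl⟩ := exists_smul_of_algA A
  have hY : ⁅diagEmb 2 C, elY 2⁆ = 0 := by
    apply Subtype.ext
    simp [diagEmb, elY, LieRing.of_associative_ring_bracket, Matrix.fromBlocks_multiply]
  have hX : ⁅diagEmb 2 C, elX 2⁆ = 0 := by
    apply Subtype.ext
    simp [diagEmb, elX, LieRing.of_associative_ring_bracket, Matrix.fromBlocks_multiply]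
  have hH : ⁅diagEmb 2 C, elH 2⁆ = 0 := by
    apply Subtype.ext
    simp [diagEmb, elH, LieRing.of_associative_ring_bracket, Matrix.fromBlocks_multiply]
  change ⁅diagEmb 2 C, a • elY 2 + b • elX 2 + c • elH 2⁆ = 0
  rw [lie_add, lie_add, lie_smul, lie_smul, lie_smul, hX, hY, hH]
  simp

end Triples

/-! ### The action of the two triples on `x(b, 0)` -/

section Action

open Sum in
theorem glLin_raiseB : glLin (raiseB : slTwo 2).1 =
    opQ (inl 0) * opP (inl 1) + opQ (inr 0) * opP (inr 1) := by
  have : (raiseB : slTwo 2).1 =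
      Matrix.single (inl 0) (inl 1) 1 + Matrix.single (inr 0) (inr 1) (1 : ℂ) := by
    ext (i | i) (j | j) <;> fin_cases i <;> fin_cases j <;>
      simp [coe_raiseB, Matrix.single]
  rw [this, map_add, glLin_single, glLin_single, one_smul, one_smul]

open Sum in
theorem glLin_lowerB : glLin (lowerB : slTwo 2).1 =
    opQ (inl 1) * opP (inl 0) + opQ (inr 1) * opP (inr 0) := by
  have : (lowerB : slTwo 2).1 =
      Matrix.single (inl 1) (inl 0) 1 + Matrix.single (inr 1) (inr 0) (1 : ℂ) := by
    ext (i | i) (j | j) <;> fin_cases i <;> fin_cases j <;>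
      simp [coe_lowerB, Matrix.single]
  rw [this, map_add, glLin_single, glLin_single, one_smul, one_smul]

open Sum in
theorem glLin_cartanB : glLin (cartanB : slTwo 2).1 =
    opQ (inl 0) * opP (inl 0) - opQ (inl 1) * opP (inl 1) +
      (opQ (inr 0) * opP (inr 0) - opQ (inr 1) * opP (inr 1)) := by
  have : (cartanB : slTwo 2).1 =
      Matrix.single (inl 0) (inl 0) 1 - Matrix.single (inl 1) (inl 1) 1 +
        (Matrix.single (inr 0) (inr 0) 1 - Matrix.single (inr 1) (inr 1) (1 : ℂ)) := by
    ext (i | i) (j | j) <;> fin_cases i <;> fin_cases j <;>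
      simp [coe_cartanB, Matrix.single]
  rw [this, map_add, map_sub, map_sub]
  simp only [glLin_single, one_smul]

open Sum in
theorem glLin_elY : glLin (elY 2).1 =
    opQ (inl 0) * opP (inr 0) + opQ (inl 1) * opP (inr 1) := by
  have : (elY 2).1 =
      Matrix.single (inl 0) (inr 0) 1 + Matrix.single (inl 1) (inr 1) (1 : ℂ) := by
    ext (i | i) (j | j) <;> fin_cases i <;> fin_cases j <;> simp [elY, Matrix.single]
  rw [this, map_add, glLin_single, glLin_single, one_smul, one_smul]

open Sum in
theorem glLin_elX : glLin (elX 2).1 =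
    opQ (inr 0) * opP (inl 0) + opQ (inr 1) * opP (inl 1) := by
  have : (elX 2).1 =
      Matrix.single (inr 0) (inl 0) 1 + Matrix.single (inr 1) (inl 1) (1 : ℂ) := by
    ext (i | i) (j | j) <;> fin_cases i <;> fin_cases j <;> simp [elX, Matrix.single]
  rw [this, map_add, glLin_single, glLin_single, one_smul, one_smul]

open Sum in
theorem glLin_elH : glLin (elH 2).1 =
    opQ (inl 0) * opP (inl 0) + opQ (inl 1) * opP (inl 1) -
      (opQ (inr 0) * opP (inr 0) + opQ (inr 1) * opP (inr 1)) := by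
  have : (elH 2).1 =
      Matrix.single (inl 0) (inl 0) 1 + Matrix.single (inl 1) (inl 1) 1 -
        (Matrix.single (inr 0) (inr 0) 1 + Matrix.single (inr 1) (inr 1) (1 : ℂ)) := by
    ext (i | i) (j | j) <;> fin_cases i <;> fin_cases j <;> simp [elH, Matrix.single]
  rw [this, map_sub, map_add, map_add]
  simp only [glLin_single, one_smul]

variable {a₁ a₂ : ℂ} (h₁ : ∀ z : ℤ, a₁ ≠ z) (h₂ : ∀ z : ℤ, a₂ ≠ z) (b : ℤ)

theorem coe_pow_toEnd_modN (𝔰 : LieSubalgebra ℂ (slTwo 2)) (A : 𝔰) (m : modN 2 a₁ a₂) (k : ℕ) :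
    (((toEnd ℂ 𝔰 (modN 2 a₁ a₂) A ^ k) m : modN 2 a₁ a₂) : Mono (Fin 2 ⊕ Fin 2)) =
      (glLin (A : slTwo 2).1 ^ k) m := by
  induction k with
  | zero => rfl
  | succ k ih =>
    rw [pow_succ', pow_succ', Module.End.mul_apply, Module.End.mul_apply, ← ih]
    rfl

theorem tuple_two (u v : ℂ) : tuple 2 u v = Sum.elim ![-1, u] ![v, 0] := by
  ext (i | i) <;> fin_cases i <;> simp [tuple]

theorem hwVec_ne_zero : hwVec 2 h₁ h₂ b ≠ 0 := by
  intro h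
  have h1 := congrArg (coeff (tuple 2 (a₁ + b) (a₂ - b))) (congrArg Subtype.val h)
  have h2 : coeff (tuple 2 (a₁ + b) (a₂ - b)) (mono (tuple 2 (a₁ + b) (a₂ - b))) = 0 :=
    h1.trans (map_zero _)
  rw [coeff_mono] at h2
  simp at h2

theorem primitiveB : tripleB.HasPrimitiveVectorWith (hwVec 2 h₁ h₂ b)
    (a₂ - a₁ - 2 * b - 1) where
  ne_zero := hwVec_ne_zero h₁ h₂ b
  lie_h := by
    apply Subtype.ext
    change glLin (cartanB : slTwo 2).1 (mono _) = _ • mono _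
    simp only [glLin_cartanB, LinearMap.add_apply, LinearMap.sub_apply, Module.End.mul_apply,
      opQ_opP_mono_self, ← sub_smul, ← add_smul, tuple_two]
    congr 1
    simp
    ring
  lie_e := by
    apply Subtype.ext
    change glLin (raiseB : slTwo 2).1 (mono _) = 0
    rw [glLin_raiseB, LinearMap.add_apply, Module.End.mul_apply, Module.End.mul_apply,
      opQ_opP_mono_eq_zero (by simp) (Or.inr (by simp [tuple_two])),
      opQ_opP_mono_eq_zero (by simp) (Or.inl (by simp [tuple_two])), add_zero]

theorem primitiveA : tripleA.HasPrimitiveVectorWith (hwVec 2 h₁ h₂ b)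
    (a₁ - a₂ + 2 * b - 1) where
  ne_zero := hwVec_ne_zero h₁ h₂ b
  lie_h := by
    apply Subtype.ext
    change glLin (elH 2).1 (mono _) = _ • mono _
    simp only [glLin_elH, LinearMap.add_apply, LinearMap.sub_apply, Module.End.mul_apply,
      opQ_opP_mono_self, ← sub_smul, ← add_smul, tuple_two]
    congr 1
    simp
    ring
  lie_e := by
    apply Subtype.ext
    change glLin (elY 2).1 (mono _) = 0
    rw [glLin_elY, LinearMap.add_apply, Module.End.mul_apply, Module.End.mul_apply,
      opQ_opP_mono_eq_zero (by simp) (Or.inr (by simp [tuple_two])),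
      opQ_opP_mono_eq_zero (by simp) (Or.inl (by simp [tuple_two])), add_zero]

theorem pow_lowerB_ne_zero (k : ℕ) :
    (toEnd ℂ (algB 2) (modN 2 a₁ a₂) lowerB ^ k) (hwVec 2 h₁ h₂ b) ≠ 0 := by
  intro h
  have h1 := coe_pow_toEnd_modN (algB 2) lowerB (hwVec 2 h₁ h₂ b) k
  rw [h, glLin_lowerB] at h1
  refine pow_move_ne_zero (Sum.inr 0) (by simp) (by simp) (by simp) ?_ ?_ (fun j => ?_) k h1.symm
  · simp [tuple_two]
  · simp [tuple_two]
  · simpa [tuple_two, add_assoc] using not_isNegInt_add_int h₁ (b + j)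

theorem pow_lowerA_ne_zero (k : ℕ) :
    (toEnd ℂ (algA 2) (modN 2 a₁ a₂) (lowerA 2) ^ k) (hwVec 2 h₁ h₂ b) ≠ 0 := by
  intro h
  have h1 := coe_pow_toEnd_modN (algA 2) (lowerA 2) (hwVec 2 h₁ h₂ b) k
  rw [h] at h1
  change _ = (glLin (elX 2).1 ^ k) _ at h1
  rw [glLin_elX] at h1
  refine pow_move_ne_zero (Sum.inl 1) (by simp) (by simp) (by simp) ?_ ?_ (fun j => ?_) k h1.symm
  · simp [tuple_two]
  · simp [tuple_two]
  · have := not_isNegInt_add_int h₂ (-b + j)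
    push_cast at this
    simpa [tuple_two, add_assoc, sub_eq_add_neg] using this

/-- Since `a₁ - a₂` is an integer, at least one of the two weights of `x(b, 0)`, which add up to
`-2`, is a negative integer. The powers of the corresponding lowering operator cannot annihilate
the nonzero vectors obtained from the other one. -/
theorem pow_lowerB_pow_lowerA_ne_zero {d : ℤ} (hd : a₁ - a₂ = d) (i j : ℕ) :
    (toEnd ℂ (algB 2) (modN 2 a₁ a₂) lowerB ^ i)
      ((toEnd ℂ (algA 2) (modN 2 a₁ a₂) (lowerA 2) ^ j) (hwVec 2 h₁ h₂ b)) ≠ 0 := by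
  have hc := fun B A => commute_toEnd (N := modN 2 a₁ a₂) lie_algB_algA B A
  rcases le_total 0 (d + 2 * b) with h | h
  · refine pow_lower_ne_zero (primitive_of_commute (primitiveB h₁ h₂ b) _
      (fun y => (hc y (lowerA 2)).pow_right j) (pow_lowerA_ne_zero h₁ h₂ b j)) (fun n hn => ?_) i
    have : ((-(d + 2 * b) - 1 : ℤ) : ℂ) = ((n : ℤ) : ℂ) := by
      push_cast; linear_combination hn + hd
    have := Int.cast_injective this
    omega
  · have hcomm := LinearMap.congr_fun ((hc lowerB (lowerA 2)).pow_pow i j).eq (hwVec 2 h₁ h₂ b)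
    rw [Module.End.mul_apply, Module.End.mul_apply] at hcomm
    rw [hcomm]
    refine pow_lower_ne_zero (primitive_of_commute (primitiveA h₁ h₂ b) _
      (fun y => ((hc lowerB y).symm.pow_right i)) (pow_lowerB_ne_zero h₁ h₂ b i))
      (fun n hn => ?_) j
    have : ((d + 2 * b - 1 : ℤ) : ℂ) = ((n : ℤ) : ℂ) := by
      push_cast; linear_combination hn - hd
    have := Int.cast_injective this
    omega

/-- The correspondence at `x(b, 0)`, for any models of the Verma modules of its two weights. -/
theorem corresponds_hwVec {d : ℤ} (hd : a₁ - a₂ = d) {lam μ : ℂ}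
    (hlam : lam = a₂ - a₁ - 2 * b - 1) (hμ : μ = a₁ - a₂ + 2 * b - 1)
    {S : Type} [AddCommGroup S] [Module ℂ S] [LieRingModule (algB 2) S] [LieModule ℂ (algB 2) S]
    {T : Type} [AddCommGroup T] [Module ℂ T] [LieRingModule (algA 2) T] [LieModule ℂ (algA 2) T]
    {s : S} (VS : IsVermaGenerator tripleB s lam) {τ : T} (VT : IsVermaGenerator tripleA τ μ) :
    Corresponds (hwVec 2 h₁ h₂ b) S T := by
  subst hlam hμ
  exact ⟨(isVermaGenerator_lieSpan (primitiveB h₁ h₂ b)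
      (pow_lowerB_ne_zero h₁ h₂ b)).nonempty_equiv exists_smul_of_algB VS,
    (isVermaGenerator_lieSpan (primitiveA h₁ h₂ b)
      (pow_lowerA_ne_zero h₁ h₂ b)).nonempty_equiv exists_smul_of_algA VT,
    exists_tensor_equiv_lieSpan lie_algB_algA (primitiveB h₁ h₂ b) (primitiveA h₁ h₂ b)
      (pow_lowerB_pow_lowerA_ne_zero h₁ h₂ b hd) exists_smul_of_algB exists_smul_of_algA VS VT⟩

end Action

end HoweSl

open HoweSl in
theorem mainTheorem3 (a₁ a₂ : ℂ) (h₁ : ∀ z : ℤ, a₁ ≠ z) (h₂ : ∀ z : ℤ, a₂ ≠ z)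
    (d : ℤ) (hd : a₁ - a₂ = d) (b : ℤ) :
    (d + 2 * b = 0 →
      LieModule.IsIrreducible ℂ (algB 2) (gen (algB 2) (hwVec 2 h₁ h₂ b)) ∧
      Corresponds (hwVec 2 h₁ h₂ b)
        (SimpleHW raiseB cartanB (-1)) (SimpleHW (raiseA 2) (cartanA 2) (-1))) ∧
    (0 < d + 2 * b →
      LieModule.IsIrreducible ℂ (algB 2) (gen (algB 2) (hwVec 2 h₁ h₂ b)) ∧
      Corresponds (hwVec 2 h₁ h₂ b)
        (SimpleHW raiseB cartanB (a₂ - a₁ - 2 * b - 1))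
        (Verma (raiseA 2) (cartanA 2) (a₁ - a₂ + 2 * b - 1))) ∧
    (d + 2 * b < 0 →
      IsIndecomposable (algB 2) (gen (algB 2) (hwVec 2 h₁ h₂ b)) ∧
      lieLength (algB 2) (gen (algB 2) (hwVec 2 h₁ h₂ b)) = 2 ∧
      Corresponds (hwVec 2 h₁ h₂ b)
        (Verma raiseB cartanB (a₂ - a₁ - 2 * b - 1))
        (SimpleHW (raiseA 2) (cartanA 2) (a₁ - a₂ + 2 * b - 1))) := by
  have VG := isVermaGenerator_lieSpan (primitiveB h₁ h₂ b) (pow_lowerB_ne_zero h₁ h₂ b)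
  have VB := isVermaGenerator_vermaGenerator (primitiveB h₁ h₂ b) (pow_lowerB_ne_zero h₁ h₂ b)
  have VA := isVermaGenerator_vermaGenerator (primitiveA h₁ h₂ b) (pow_lowerA_ne_zero h₁ h₂ b)
  have cor := @corresponds_hwVec a₁ a₂ h₁ h₂ b d hd
  have hlam : a₂ - a₁ - 2 * (b : ℂ) - 1 = ((-(d + 2 * b) - 1 : ℤ) : ℂ) := by
    push_cast; linear_combination -hd
  have hμ : a₁ - a₂ + 2 * (b : ℂ) - 1 = ((d + 2 * b - 1 : ℤ) : ℂ) := by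
    push_cast; linear_combination hd
  have hnat : ∀ {z : ℂ} {k : ℤ}, z = k → k < 0 → ∀ n : ℕ, z ≠ n := by
    rintro z k rfl hk n hn
    have := Int.cast_injective (hn.trans (Int.cast_natCast n).symm)
    omega
  refine ⟨fun h => ?_, fun h => ?_, fun h => ?_⟩
  · refine ⟨VG.isIrreducible exists_smul_of_algB (hnat hlam (by omega)), ?_⟩
    have e1 : a₂ - a₁ - 2 * (b : ℂ) - 1 = -1 := by rw [hlam, h]; simp
    have e2 : a₁ - a₂ + 2 * (b : ℂ) - 1 = -1 := by rw [hμ, h]; simp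
    rw [e1] at VB
    rw [e2] at VA
    have hm : ∀ n : ℕ, (-1 : ℂ) ≠ n := hnat (k := -1) (by simp) (by norm_num)
    exact cor e1.symm e2.symm (VB.simpleHW exists_smul_of_algB hm)
      (VA.simpleHW exists_smul_of_algA hm)
  · exact ⟨VG.isIrreducible exists_smul_of_algB (hnat hlam (by omega)),
      cor rfl rfl (VB.simpleHW exists_smul_of_algB (hnat hlam (by omega))) VA⟩
  · refine ⟨?_, ?_, cor rfl rfl VB (VA.simpleHW exists_smul_of_algA (hnat hμ (by omega)))⟩
    all_goals
      obtain ⟨n, hn⟩ := Int.eq_ofNat_of_zero_le (show 0 ≤ -(d + 2 * b) - 1 by omega)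
      rw [hlam, hn] at VG
    · exact ⟨⟨_, 0, VG.primitive.ne_zero⟩, VG.not_isCompl exists_smul_of_algB⟩
    · exact VG.height_top exists_smul_of_algB
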